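/- **Setting.** Manifolds are smooth, Hausdorff and second countable. Let $m\ge 2$, and let $\mathbb L^{m+2}$ be Lorentz–Minkowski space with a basis $(\ell,e_1,\dots,e_m,n)$ such that $\langle \ell,n\rangle=1$, $\langle e_i,e_j\rangle=\delta_{ij}$, all other products of basis vectors vanish, and $\ell$ lies on the future lightlike cone. Let $O^+(m+1,1)$ be the group of linear isometries preserving the future lightlike cone, $\mathfrak g$ its Lie algebra, $H$ the isotropy subgroup of $\ell$, and $\mathfrak h=\mathrm{Lie}(H)$. Identify $\mathfrak g/\mathfrak h\cong\mathbb R\times\mathbb R^m$ by sending the class of $A$ with $A\ell=a\ell+\sum_i X_ie_i$ to $(a,X)$, and put $q((a,X),(b,Y))=\sum_i X_iY_i$. A *lightlike Cartan geometry* $(p:\mathcal P\to N,\omega)$ on a connected $(m+1)$-dimensional manifold $N$ is a Cartan geometry of type $(O^+(m+1,1),H)$: a principal $H$-bundle $p:\mathcal P\to N$ with a smooth $\omega\in\Omega^1(\mathcal P,\mathfrak g)$ such that every $\omega(u)$ is a linear isomorphism, $(r^a)^*\omega=\mathrm{Ad}(a^{-1})\circ\omega$ for $a\in H$, and $\omega(\zeta_A)=A$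 for the fundamental vector field $\zeta_A$ of each $A\in\mathfrak h$. For $u\in\mathcal P$ over $x$, $\phi_u:T_xN\to\mathfrak g/\mathfrak h$ is the isomorphism with $\phi_u(T_up\cdot\zeta)=\omega(u)(\zeta)+\mathfrak h$. The standard tractor bundle is $\mathcal T=\mathcal P\times_H\mathbb L^{m+2}$, with the metric $\mathbf h([u,v_1],[u,v_2])=\langle v_1,v_2\rangle$, the section $\xi=[u,\ell]$, and the tractor connection $\nabla^{\mathcal T}$: if the section $T$ corresponds to the $H$-equivariant function $\hat T:\mathcal P\to\mathbb L^{m+2}$, then $\nabla^{\mathcal T}_wT=[u,d\hat T(\zeta)+\omega(\zeta)\hat T(u)]$ for any $\zeta\in T_u\mathcal P$ with $T_up\cdot\zeta=w$. Put $\Phi(w)=\nabla^{\mathcal T}_w\xi$. For a symmetric $(0,2)$-tensor $h$ and a vector field $Z$ on $N$, let $S(N,h,Z)$ be the set of smooth $1$-forms $\tau$ with $\tau(Z)=1$, and put $\mathrm{An}(\tau)=\ker\tau$, $P^\tau(v)=v-\tau(v)Z$, and $L_{\tau,\bar\tau}=\sum_{i=1}^m\tau(E_i)E_i$ for any local $h$-orthonormal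 frame $(E_i)$ of $\mathrm{An}(\bar\tau)$. **Theorem.** Let $(p:\mathcal P\to N,\omega)$ be a lightlike Cartan geometry. Then $N$ is endowed with the following structures. 1. The tensor $h^\omega$ and the vector field $Z^\omega$ with $h^\omega(v,w)=q(\phi_u(v),\phi_u(w))$ and $\phi_u(Z^\omega)=(1,0)$ for every $u\in\mathcal P$ exist. $h^\omega$ is a lightlike metric (a smooth symmetric positive semidefinite $(0,2)$-tensor field with one-dimensional radical at every point), and $Z^\omega$ is smooth and spans its radical distribution. 2. There are maps that assign to each $\tau\in S(N,h^\omega,Z^\omega)$ a metric linear connection $\nabla^\tau$ on the vector bundle $(\mathrm{An}(\tau)\to N,h^\omega)$ and a smooth vector bundle morphism $D^\tau:TN\to\mathrm{An}(\tau)$. They are the ones given by the tractor connection: there is a smooth section $\eta^\tau$ of $\mathcal T$ with $\mathbf h(\eta^\tau,\eta^\tau)=0$, $\mathbf h(\xi,\eta^\tau)=1$ and $\mathbf h(\Phi(\mathrm{An}(\tau)),\eta^\tau)=0$, and, writing $(\alpha,X,\beta)$ for the section $\alpha\xi+\Phi(X)+\beta\eta^\tau$, $$\nabla^{\mathcal T}_W(\alpha,X,\beta)=\big(W(\alpha)+\alpha\tau(W)-h^\omega(X,D^\tau(W)),\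 \alpha P^\tau(W)+\beta D^\tau(W)+\nabla^\tau_WX,\ W(\beta)-\beta\tau(W)-h^\omega(X,W)\big)$$ for all $\alpha,\beta\in C^\infty(N)$, $X\in\Gamma(\mathrm{An}(\tau))$, $W\in\mathfrak X(N)$. 3. For all $\tau,\bar\tau\in S(N,h^\omega,Z^\omega)$, $X\in\Gamma(\mathrm{An}(\tau))$ and $W\in\mathfrak X(N)$, $$\nabla^{\bar\tau}_W(P^{\bar\tau}(X))=P^{\bar\tau}\big(\nabla^\tau_WX-\bar\tau(X)W\big)-h^\omega(X,W)L_{\tau,\bar\tau},$$ $$D^{\bar\tau}(W)=P^{\bar\tau}\Big(D^\tau(W)+\tfrac12h^\omega(L_{\tau,\bar\tau},L_{\tau,\bar\tau})W\Big)-\tau(W)L_{\tau,\bar\tau}-\nabla^{\bar\tau}_WL_{\tau,\bar\tau}.$$ -/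

import Mathlib

open scoped Manifold ContDiff Matrix

noncomputable section

namespace LightlikeCartan

/-! ### The model `(O⁺(m+1,1), H)` -/

/-- Index set of the basis `(ℓ, e₁, …, e_m, n)` of `𝕃^{m+2}`. -/
abbrev Idx (m : ℕ) : Type := Unit ⊕ (Fin m ⊕ Unit)

/-- Lorentz-Minkowski space in the coordinates of the basis `(ℓ, e₁, …, e_m, n)`. -/
abbrev Vec (m : ℕ) : Type := Idx m → ℝ

abbrev Mat (m : ℕ) : Type := Matrix (Idx m) (Idx m) ℝ

/-- The index of `ℓ`. -/
abbrev iL (m : ℕ) : Idx m := Sum.inl ()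

/-- The index of `eᵢ`. -/
abbrev iE {m : ℕ} (i : Fin m) : Idx m := Sum.inr (Sum.inl i)

/-- The index of `n`. -/
abbrev iN (m : ℕ) : Idx m := Sum.inr (Sum.inr ())

/-- The Gram matrix of the Lorentzian metric: `⟨ℓ, n⟩ = 1`, `⟨eᵢ, eⱼ⟩ = δᵢⱼ`, and all other products
of basis vectors vanish. -/
def gram (m : ℕ) : Mat m := fun i j =>
  match i, j with
  | Sum.inl _, Sum.inr (Sum.inr _) => 1
  | Sum.inr (Sum.inr _), Sum.inl _ => 1
  | Sum.inr (Sum.inl a), Sum.inr (Sum.inl b) => if a = b then 1 else 0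
  | _, _ => 0

/-- The Lorentzian metric `⟨v, w⟩`. -/
def lor {m : ℕ} (v w : Vec m) : ℝ := v ⬝ᵥ (gram m *ᵥ w)

/-- The basis vector `ℓ`. -/
def vecL (m : ℕ) : Vec m := Pi.single (iL m) 1

/-- The basis vector `n`. -/
def vecN (m : ℕ) : Vec m := Pi.single (iN m) 1

/-- The future lightlike cone, for the time orientation of the timelike vector `ℓ - n`, so that
`ℓ` belongs to it. -/
def futureCone (m : ℕ) : Set (Vec m) := {v | lor v v = 0 ∧ lor v (vecL m - vecN m) < 0}

/-- The Lorentz group `O(m+1,1)`. -/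
def lorentz (m : ℕ) : Subgroup (Matrix.GeneralLinearGroup (Idx m) ℝ) where
  carrier := {σ | (σ : Mat m)ᵀ * gram m * (σ : Mat m) = gram m}
  one_mem' := by simp
  mul_mem' := by
    intro a b ha hb
    simp only [Set.mem_ofPred_eq] at ha hb ⊢
    calc _ = (b : Mat m)ᵀ * ((a : Mat m)ᵀ * gram m * (a : Mat m)) * (b : Mat m) := by
            simp [Matrix.transpose_mul, Matrix.mul_assoc]
      _ = gram m := by rw [ha, hb]
  inv_mem' := by
    intro a ha
    simp only [Set.mem_ofPred_eq] at ha ⊢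
    have h1 : (a : Mat m) * ((a⁻¹ : Matrix.GeneralLinearGroup (Idx m) ℝ) : Mat m) = 1 := by
      rw [← Units.val_mul, mul_inv_cancel, Units.val_one]
    have h2 : ((a⁻¹ : Matrix.GeneralLinearGroup (Idx m) ℝ) : Mat m)ᵀ * (a : Mat m)ᵀ = 1 := by
      rw [← Matrix.transpose_mul, h1, Matrix.transpose_one]
    set b : Mat m := ((a⁻¹ : Matrix.GeneralLinearGroup (Idx m) ℝ) : Mat m)
    calc bᵀ * gram m * b = bᵀ * ((a : Mat m)ᵀ * gram m * (a : Mat m)) * b := by rw [ha]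
      _ = (bᵀ * (a : Mat m)ᵀ) * gram m * ((a : Mat m) * b) := by simp only [Matrix.mul_assoc]
      _ = gram m := by rw [h1, h2]; simp

/-- The orthochronous Lorentz group `O⁺(m+1,1)`: the elements of `O(m+1,1)` that preserve the future
lightlike cone. -/
def orthochronous (m : ℕ) : Subgroup (Matrix.GeneralLinearGroup (Idx m) ℝ) where
  carrier := {σ | σ ∈ lorentz m ∧ ∀ v : Vec m, (σ : Mat m) *ᵥ v ∈ futureCone m ↔ v ∈ futureCone m}
  one_mem' := ⟨one_mem _, by simp⟩
  mul_mem' := by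
    rintro a b ⟨ha, ha'⟩ ⟨hb, hb'⟩
    refine ⟨mul_mem ha hb, fun v => ?_⟩
    rw [Units.val_mul, ← Matrix.mulVec_mulVec, ha', hb']
  inv_mem' := by
    rintro a ⟨ha, ha'⟩
    refine ⟨inv_mem ha, fun v => ?_⟩
    rw [← ha' (((a⁻¹ : Matrix.GeneralLinearGroup (Idx m) ℝ) : Mat m) *ᵥ v), Matrix.mulVec_mulVec,
      ← Units.val_mul, mul_inv_cancel, Units.val_one, Matrix.one_mulVec]

/-- The group `H`: the isotropy subgroup of `ℓ` in `O⁺(m+1,1)`. -/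
def grpH (m : ℕ) : Subgroup (Matrix.GeneralLinearGroup (Idx m) ℝ) where
  carrier := {σ | σ ∈ orthochronous m ∧ (σ : Mat m) *ᵥ vecL m = vecL m}
  one_mem' := ⟨one_mem _, by simp⟩
  mul_mem' := by
    rintro a b ⟨ha, ha'⟩ ⟨hb, hb'⟩
    refine ⟨mul_mem ha hb, ?_⟩
    rw [Units.val_mul, ← Matrix.mulVec_mulVec, hb', ha']
  inv_mem' := by
    rintro a ⟨ha, ha'⟩
    refine ⟨inv_mem ha, ?_⟩
    conv_lhs => rw [← ha']
    rw [Matrix.mulVec_mulVec, ← Units.val_mul, inv_mul_cancel, Units.val_one, Matrix.one_mulVec]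

/-- The matrix of an element of `H`. -/
def matH {m : ℕ} (a : grpH m) : Mat m := ((a : Matrix.GeneralLinearGroup (Idx m) ℝ) : Mat m)

/-- The entries of an element of `H`. This realizes `H` as a closed embedded submanifold of the
space of all square arrays of numbers, which is how `H` carries its Lie group structure. -/
def entries {m : ℕ} (a : grpH m) : Idx m → Idx m → ℝ := fun i j => matH a i j

/-- A left inverse of `entries` (its values off the range of `entries` are never used). -/
def ofEntries {m : ℕ} : (Idx m → Idx m → ℝ) → grpH m := Function.invFun entries

/-- The Lie algebra `𝔤` of `O⁺(m+1,1)`: all `A` with `Aᵀ S + S A = 0`, for the Gram matrix `S`. -/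
def lieG (m : ℕ) : Submodule ℝ (Mat m) where
  carrier := {A | Aᵀ * gram m + gram m * A = 0}
  zero_mem' := by simp
  add_mem' := by
    intro a b ha hb
    simp only [Set.mem_ofPred_eq] at ha hb ⊢
    have h : (a + b)ᵀ * gram m + gram m * (a + b)
        = (aᵀ * gram m + gram m * a) + (bᵀ * gram m + gram m * b) := by
      rw [Matrix.transpose_add]; noncomm_ring
    rw [h, ha, hb, add_zero]
  smul_mem' := by
    intro c a ha
    simp only [Set.mem_ofPred_eq] at ha ⊢
    rw [Matrix.transpose_smul, Matrix.smul_mul, Matrix.mul_smul, ← smul_add, ha, smul_zero]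

/-- The Lie algebra `𝔥` of `H`: the elements of `𝔤` that annihilate `ℓ`. -/
def lieH (m : ℕ) : Submodule ℝ (Mat m) where
  carrier := {A | A ∈ lieG m ∧ A *ᵥ vecL m = 0}
  zero_mem' := ⟨zero_mem _, by simp⟩
  add_mem' := by
    rintro a b ⟨ha, ha'⟩ ⟨hb, hb'⟩
    exact ⟨add_mem ha hb, by rw [Matrix.add_mulVec, ha', hb', add_zero]⟩
  smul_mem' := by
    rintro c a ⟨ha, ha'⟩
    exact ⟨(lieG m).smul_mem c ha, by rw [Matrix.smul_mulVec, ha', smul_zero]⟩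

theorem gram_mul_gram (m : ℕ) : gram m * gram m = 1 := by
  ext i j
  rcases i with _ | _ | _ <;> rcases j with _ | _ | _ <;>
    simp [Matrix.mul_apply, gram, Matrix.one_apply]

theorem lor_vecL {m : ℕ} (v : Vec m) : lor v (vecL m) = v (iN m) := by
  simp [lor, dotProduct, Matrix.mulVec, vecL, gram]

theorem lor_vecN {m : ℕ} (v : Vec m) : lor v (vecN m) = v (iL m) := by
  simp [lor, dotProduct, Matrix.mulVec, vecN, gram]

theorem lor_self {m : ℕ} (v : Vec m) :
    lor v v = 2 * v (iL m) * v (iN m) + ∑ i : Fin m, v (iE i) ^ 2 := by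
  simp [lor, dotProduct, Matrix.mulVec, gram, Fintype.sum_sum_type, Finset.sum_ite_eq, sq]
  ring

theorem mem_futureCone_iff {m : ℕ} (v : Vec m) :
    v ∈ futureCone m ↔ lor v v = 0 ∧ v (iN m) < v (iL m) := by
  have h : lor v (vecL m - vecN m) = v (iN m) - v (iL m) := by
    rw [← lor_vecL v, ← lor_vecN v]
    simp only [lor, Matrix.mulVec_sub, dotProduct_sub]
  rw [futureCone, Set.mem_ofPred_eq, h, sub_neg]

theorem lor_mulVec {m : ℕ} {A : Mat m} (hA : Aᵀ * gram m * A = gram m) (v w : Vec m) :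
    lor (A *ᵥ v) (A *ᵥ w) = lor v w := by
  unfold lor
  have h : A *ᵥ v = v ᵥ* Aᵀ := (Matrix.vecMul_transpose A v).symm
  rw [h, ← Matrix.dotProduct_mulVec, Matrix.mulVec_mulVec, Matrix.mulVec_mulVec, hA]

/-- A Lorentz transformation that fixes `ℓ` preserves the future cone. -/
theorem mem_grpH_of_fix {m : ℕ} {a : Matrix.GeneralLinearGroup (Idx m) ℝ}
    (ha : (a : Mat m)ᵀ * gram m * (a : Mat m) = gram m)
    (hl : (a : Mat m) *ᵥ vecL m = vecL m) : a ∈ grpH m := by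
  refine ⟨⟨ha, fun v => ?_⟩, hl⟩
  set w := (a : Mat m) *ᵥ v with hw
  have hN : w (iN m) = v (iN m) := by
    rw [← lor_vecL w, ← lor_vecL v, ← lor_mulVec ha v (vecL m), hl]
  have hnull : lor w w = lor v v := lor_mulVec ha v v
  rw [mem_futureCone_iff, mem_futureCone_iff, hnull]
  refine and_congr_right fun h0 => ?_
  have hw0 := hnull.trans h0
  have h0' := h0
  rw [lor_self] at hw0 h0
  have sv : 0 ≤ ∑ i : Fin m, v (iE i) ^ 2 := Finset.sum_nonneg fun i _ => sq_nonneg _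
  have sw : 0 ≤ ∑ i : Fin m, w (iE i) ^ 2 := Finset.sum_nonneg fun i _ => sq_nonneg _
  rw [hN] at hw0 ⊢
  rcases lt_trichotomy (v (iN m)) 0 with hb | hb | hb
  · have h1 : 0 ≤ v (iL m) := by nlinarith
    have h2 : 0 ≤ w (iL m) := by nlinarith
    constructor <;> intro <;> linarith
  · have hz : ∀ i : Fin m, v (iE i) = 0 := by
      have hs : ∑ i : Fin m, v (iE i) ^ 2 = 0 := by rw [hb] at h0; linarith
      intro i
      have := (Finset.sum_eq_zero_iff_of_nonneg (fun i _ => sq_nonneg (v (iE i)))).1 hs i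
        (Finset.mem_univ i)
      simpa using this
    have hv : v = v (iL m) • vecL m := by
      ext j
      rcases j with _ | j | _
      · simp [vecL]
      · simpa [vecL] using hz j
      · simpa [vecL] using hb
    have hwv : w = v := by
      rw [hw, hv, Matrix.mulVec_smul, hl]
    rw [hwv]
  · have h1 : v (iL m) ≤ 0 := by nlinarith
    have h2 : w (iL m) ≤ 0 := by nlinarith
    constructor <;> intro <;> linarith

theorem exp_mulVec_of_mulVec_eq_zero {m : ℕ} {A : Mat m} {v : Vec m} (h : A *ᵥ v = 0) :
    NormedSpace.exp A *ᵥ v = v := by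
  have hs : HasSum (fun k : ℕ => ((k.factorial : ℝ)⁻¹ • A ^ k)) (NormedSpace.exp A) :=
    open scoped Matrix.Norms.Operator in NormedSpace.exp_series_hasSum_exp' (𝕂 := ℝ) A
  have hs' : HasSum (fun k : ℕ => ((k.factorial : ℝ)⁻¹ • A ^ k) *ᵥ v) (NormedSpace.exp A *ᵥ v) :=
    hs.map (AddMonoidHom.mk' (fun B : Mat m => B *ᵥ v) fun B C => Matrix.add_mulVec B C v)
      (Continuous.matrix_mulVec continuous_id continuous_const)
  have h1 : HasSum (fun k : ℕ => ((k.factorial : ℝ)⁻¹ • A ^ k) *ᵥ v) v := by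
    have := hasSum_single (f := fun k : ℕ => ((k.factorial : ℝ)⁻¹ • A ^ k) *ᵥ v) 0 (by
      intro k hk
      obtain ⟨k, rfl⟩ := Nat.exists_eq_succ_of_ne_zero hk
      rw [Matrix.smul_mulVec, Nat.succ_eq_add_one, pow_succ, ← Matrix.mulVec_mulVec, h,
        Matrix.mulVec_zero, smul_zero])
    simpa using this
  exact hs'.unique h1

theorem exp_mem_grpH {m : ℕ} (A : lieH m) :
    (Matrix.isUnit_exp (A : Mat m)).unit ∈ grpH m := by
  obtain ⟨A, hA, hl⟩ := A
  have hA' : Aᵀ * gram m + gram m * A = 0 := hA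
  have hinv : (gram m)⁻¹ = gram m := Matrix.inv_eq_left_inv (gram_mul_gram m)
  have hu : IsUnit (gram m) := ⟨⟨gram m, gram m, gram_mul_gram m, gram_mul_gram m⟩, rfl⟩
  have hT : Aᵀ = gram m * (-A) * (gram m)⁻¹ := by
    rw [hinv, Matrix.mul_neg, ← eq_neg_of_add_eq_zero_left hA', Matrix.mul_assoc, gram_mul_gram,
      Matrix.mul_one]
  apply mem_grpH_of_fix
  · simp only [IsUnit.unit_spec]
    rw [← Matrix.exp_transpose, hT, Matrix.exp_conj _ _ hu, hinv,
      Matrix.mul_assoc _ _ (gram m), gram_mul_gram, Matrix.mul_one, Matrix.mul_assoc,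
      Matrix.exp_neg, Matrix.nonsing_inv_mul _ ((Matrix.isUnit_iff_isUnit_det _).1
        (Matrix.isUnit_exp A)), Matrix.mul_one]
  · simp only [IsUnit.unit_spec]
    exact exp_mulVec_of_mulVec_eq_zero hl

/-- The one-parameter subgroup element `exp A ∈ H` for `A ∈ 𝔥`. -/
def expH {m : ℕ} (A : lieH m) : grpH m := ⟨(Matrix.isUnit_exp (A : Mat m)).unit, exp_mem_grpH A⟩

/-- The identification `𝔤/𝔥 ≅ ℝ × ℝᵐ`: the class of the matrix with first column `(a, X, 0)` is
sent to `(a, X)`. -/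
def modH {m : ℕ} (A : Mat m) : ℝ × (Fin m → ℝ) := (A (iL m) (iL m), fun i => A (iE i) (iL m))

/-- The `H`-invariant degenerate metric `q` on `𝔤/𝔥 ≅ ℝ × ℝᵐ`. -/
def qForm {m : ℕ} (Y Y' : ℝ × (Fin m → ℝ)) : ℝ := ∑ i, Y.2 i * Y'.2 i

/-! ### Lightlike Cartan geometries -/

/-- A principal fibre bundle `proj : P → N` with structure group `H`, over an `(m+1)`-dimensional
manifold. Smoothness of maps out of `H` and into `H` refers to the embedding `entries`. -/
structure PrincipalHBundle (m d : ℕ)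
    (N : Type*) [TopologicalSpace N] [ChartedSpace (EuclideanSpace ℝ (Fin (m + 1))) N]
    (P : Type*) [TopologicalSpace P] [ChartedSpace (EuclideanSpace ℝ (Fin d)) P] where
  proj : P → N
  contMDiff_proj : ContMDiff (𝓡 d) (𝓡 (m + 1)) ∞ proj
  /-- The right action `(u, a) ↦ u · a`. -/
  act : P → grpH m → P
  act_one : ∀ u, act u 1 = u
  act_mul : ∀ u a b, act u (a * b) = act (act u a) b
  contMDiff_act : ContMDiffOn ((𝓡 d).prod 𝓘(ℝ, Idx m → Idx m → ℝ)) (𝓡 d) ∞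
    (fun z : P × (Idx m → Idx m → ℝ) => act z.1 (ofEntries z.2))
    (Set.univ ×ˢ Set.range (entries (m := m)))
  proj_act : ∀ u a, proj (act u a) = proj u
  act_free : ∀ u a, act u a = u → a = 1
  act_transitive : ∀ u v, proj u = proj v → ∃ a, act u a = v
  /-- Local triviality: near each point there is a smooth section `s`, and the inverse
  `u ↦ (proj u, ψ u)` of the equivariant bijection `(y, a) ↦ s y · a` is smooth. -/
  locally_trivial : ∀ x : N, ∃ U : Set N, IsOpen U ∧ x ∈ U ∧ ∃ (s : N → P) (ψ : P → grpH m),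
    ContMDiffOn (𝓡 (m + 1)) (𝓡 d) ∞ s U ∧
    ContMDiffOn (𝓡 d) 𝓘(ℝ, Idx m → Idx m → ℝ) ∞ (fun u => entries (ψ u)) (proj ⁻¹' U) ∧
    (∀ y ∈ U, proj (s y) = y) ∧
    ∀ u ∈ proj ⁻¹' U, act (s (proj u)) (ψ u) = u

/-- A lightlike Cartan geometry: a Cartan geometry of type `(O⁺(m+1,1), H)` on `N`. -/
structure LightlikeCartanGeometry (m d : ℕ)
    (N : Type*) [TopologicalSpace N] [ChartedSpace (EuclideanSpace ℝ (Fin (m + 1))) N]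
    (P : Type*) [TopologicalSpace P] [ChartedSpace (EuclideanSpace ℝ (Fin d)) P]
    [IsManifold (𝓡 d) ∞ P]
    extends PrincipalHBundle m d N P where
  /-- The Cartan connection. -/
  omega : ∀ u : P, TangentSpace (𝓡 d) u →ₗ[ℝ] lieG m
  contMDiff_omega : ∀ i j : Idx m, ContMDiff (𝓡 d).tangent 𝓘(ℝ, ℝ) ∞
    (fun v : TangentBundle (𝓡 d) P => (omega v.1 v.2 : Mat m) i j)
  omega_bijective : ∀ u, Function.Bijective (omega u)
  /-- `(r^a)^* ω = Ad(a⁻¹) ∘ ω`. -/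
  omega_equivariant : ∀ (u : P) (a : grpH m) (v : TangentSpace (𝓡 d) u),
    (omega (act u a) (mfderiv (𝓡 d) (𝓡 d) (fun w => act w a) u v) : Mat m)
      = matH a⁻¹ * (omega u v : Mat m) * matH a
  /-- `ω(ζ_A) = A`, where `ζ_A(u)` is the velocity at `t = 0` of `t ↦ u · exp(tA)`, a curve that
  starts at `u · exp(0 A) = u`. -/
  omega_fundamental : ∀ (u : P) (A : lieH m),
    (omega (act u (expH ((0 : ℝ) • A)))
      (mfderiv 𝓘(ℝ, ℝ) (𝓡 d) (fun t : ℝ => act u (expH (t • A))) 0 (1 : ℝ)) : Mat m) = (A : Mat m)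

/-! ### Tensors on a manifold -/

section Tensors

variable (n : ℕ) (N : Type*) [TopologicalSpace N] [ChartedSpace (EuclideanSpace ℝ (Fin n)) N]

/-- Vector fields. -/
abbrev VField : Type _ := ∀ x : N, TangentSpace (𝓡 n) x

/-- `1`-forms. -/
abbrev OneForm : Type _ := ∀ x : N, TangentSpace (𝓡 n) x →L[ℝ] ℝ

/-- `(0,2)`-tensor fields. -/
abbrev BilinField : Type _ := ∀ x : N, TangentSpace (𝓡 n) x →L[ℝ] TangentSpace (𝓡 n) x →L[ℝ] ℝ

/-- Fields of endomorphisms of the tangent bundle. -/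
abbrev EndField : Type _ := ∀ x : N, TangentSpace (𝓡 n) x →L[ℝ] TangentSpace (𝓡 n) x

variable {n N}

/-- The function `W(f)`. -/
def dirDeriv (W : VField n N) (f : N → ℝ) (x : N) : ℝ := mfderiv (𝓡 n) 𝓘(ℝ, ℝ) f x (W x)

/-- Smooth functions on `N`. -/
def IsSmoothFun (f : N → ℝ) : Prop := ContMDiff (𝓡 n) 𝓘(ℝ, ℝ) ∞ f

section Smooth

variable [IsManifold (𝓡 n) ∞ N]

/-- Smooth vector fields. -/
def IsSmoothField (W : VField n N) : Prop :=
  ContMDiff (𝓡 n) (𝓡 n).tangent ∞ (fun x => (⟨x, W x⟩ : TangentBundle (𝓡 n) N))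

/-- Smooth `1`-forms, as smooth functions on the tangent bundle. -/
def IsSmoothForm (τ : OneForm n N) : Prop :=
  ContMDiff (𝓡 n).tangent 𝓘(ℝ, ℝ) ∞ (fun v : TangentBundle (𝓡 n) N => τ v.1 v.2)

/-- `h` is a lightlike metric: a smooth symmetric `(0,2)`-tensor field, positive semidefinite, whose
radical is one-dimensional at every point. -/
structure IsLightlikeMetric (h : BilinField n N) : Prop where
  smooth : ∀ V W : VField n N, IsSmoothField V → IsSmoothField W →
    IsSmoothFun (n := n) (fun x => h x (V x) (W x))
  symm : ∀ x v w, h x v w = h x w v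
  nonneg : ∀ x v, 0 ≤ h x v v
  radical : ∀ x, Module.finrank ℝ (LinearMap.ker (h x).toLinearMap) = 1

/-- `Z` is a smooth vector field that spans the radical distribution of `h`. -/
structure SpansRadical (h : BilinField n N) (Z : VField n N) : Prop where
  smooth : IsSmoothField Z
  span : ∀ x, LinearMap.ker (h x).toLinearMap = Submodule.span ℝ {Z x}

/-- The set `S(N, h, Z)` of the `1`-forms `τ` with `τ(Z) = 1`. -/
def screenForms (Z : VField n N) : Set (OneForm n N) :=
  {τ | IsSmoothForm τ ∧ ∀ x, τ x (Z x) = 1}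

/-- `Γ(An(τ))`: smooth vector fields annihilated by `τ`. -/
def screenSections (τ : OneForm n N) : Set (VField n N) :=
  {X | IsSmoothField X ∧ ∀ x, τ x (X x) = 0}

/-- `cov` is a metric linear connection on the vector bundle `(An(τ) → N, h)`;
`cov X x (W x)` is the value at `x` of `∇_W X`. -/
structure IsMetricConnection (h : BilinField n N) (τ : OneForm n N)
    (cov : VField n N → EndField n N) : Prop where
  mem : ∀ X ∈ screenSections τ, ∀ W, IsSmoothField W →
    (fun x => cov X x (W x)) ∈ screenSections τ
  add : ∀ X ∈ screenSections τ, ∀ Y ∈ screenSections τ, ∀ x w,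
    cov (fun y => X y + Y y) x w = cov X x w + cov Y x w
  leibniz : ∀ f : N → ℝ, IsSmoothFun (n := n) f → ∀ X ∈ screenSections τ,
    ∀ W : VField n N, ∀ x,
    cov (fun y => f y • X y) x (W x) = dirDeriv W f x • X x + f x • cov X x (W x)
  metric : ∀ X ∈ screenSections τ, ∀ Y ∈ screenSections τ, ∀ W, IsSmoothField W → ∀ x,
    dirDeriv W (fun y => h y (X y) (Y y)) x
      = h x (cov X x (W x)) (Y x) + h x (X x) (cov Y x (W x))

/-- `D` is a (smooth) vector bundle morphism `TN → An(τ)`. -/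
structure IsScreenMorphism (τ : OneForm n N) (D : EndField n N) : Prop where
  smooth : ContMDiff (𝓡 n).tangent (𝓡 n).tangent ∞
    (fun v : TangentBundle (𝓡 n) N => (⟨v.1, D v.1 v.2⟩ : TangentBundle (𝓡 n) N))
  mem : ∀ x v, τ x (D x v) = 0

end Smooth

/-- `P^τ(v) = v - τ(v) Z`. -/
def screenProj (Z : VField n N) (τ : OneForm n N) (x : N) (v : TangentSpace (𝓡 n) x) :
    TangentSpace (𝓡 n) x := v - τ x v • Z x

/-- An `h`-orthonormal frame `(E₁, …, E_m)` of the fibre of `An(τ)` at `x`, for `dim N = m + 1`. -/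
def screenFrame {m : ℕ} {N : Type*} [TopologicalSpace N]
    [ChartedSpace (EuclideanSpace ℝ (Fin (m + 1))) N]
    (h : BilinField (m + 1) N) (τ : OneForm (m + 1) N) (x : N) :
    Fin m → TangentSpace (𝓡 (m + 1)) x :=
  Classical.epsilon fun e => (∀ i, τ x (e i) = 0) ∧
    ∀ i j, h x (e i) (e j) = if i = j then 1 else 0

/-- `L_{τ,τ'} = ∑ᵢ τ(Eᵢ) Eᵢ` for an `h`-orthonormal frame `(Eᵢ)` of `An(τ')`; it does not depend on
the frame. -/
def diffField {m : ℕ} {N : Type*} [TopologicalSpace N]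
    [ChartedSpace (EuclideanSpace ℝ (Fin (m + 1))) N]
    (h : BilinField (m + 1) N) (τ τ' : OneForm (m + 1) N) : VField (m + 1) N :=
  fun x => ∑ i, τ x (screenFrame h τ' x i) • screenFrame h τ' x i

end Tensors

/-! ### The structures induced by a lightlike Cartan geometry -/

namespace LightlikeCartanGeometry

variable {m d : ℕ}
  {N : Type*} [TopologicalSpace N] [ChartedSpace (EuclideanSpace ℝ (Fin (m + 1))) N]
  {P : Type*} [TopologicalSpace P] [ChartedSpace (EuclideanSpace ℝ (Fin d)) P]
  [IsManifold (𝓡 d) ∞ P]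
  (C : LightlikeCartanGeometry m d N P)

/-- The tangent map `T_u proj`. -/
abbrev dproj (u : P) : TangentSpace (𝓡 d) u →L[ℝ] TangentSpace (𝓡 (m + 1)) (C.proj u) :=
  mfderiv (𝓡 d) (𝓡 (m + 1)) C.proj u

/-- `h` is the metric on `N` that corresponds to `q` under the isomorphisms
`φ_u : T_x N → 𝔤/𝔥`, `φ_u (T_u proj ζ) = ω(u)(ζ) + 𝔥`. -/
def IsInducedMetric (h : BilinField (m + 1) N) : Prop :=
  ∀ (u : P) (ζ ζ' : TangentSpace (𝓡 d) u),
    h (C.proj u) (C.dproj u ζ) (C.dproj u ζ')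
      = qForm (modH (C.omega u ζ : Mat m)) (modH (C.omega u ζ' : Mat m))

/-- `Z` is the vector field on `N` that corresponds to `(1, 0)` under the isomorphisms `φ_u`. -/
def IsInducedField (Z : VField (m + 1) N) : Prop :=
  ∀ (u : P) (ζ : TangentSpace (𝓡 d) u),
    C.dproj u ζ = Z (C.proj u) ↔ modH (C.omega u ζ : Mat m) = (1, 0)

/-- A smooth section of the standard tractor bundle `𝒯 = P ×_H 𝕃^{m+2}`, given by its
`H`-equivariant function `T : P → 𝕃^{m+2}`: the section is `x ↦ [u, T u]` for any `u` over `x`. -/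
structure IsTractorSection (T : P → Vec m) : Prop where
  smooth : ContMDiff (𝓡 d) 𝓘(ℝ, Vec m) ∞ T
  equivariant : ∀ u a, T (C.act u a) = matH a⁻¹ *ᵥ T u

/-- A linear right inverse of `T_u proj`, that is, a choice of lifts of tangent vectors of `N`. -/
def lift (u : P) : TangentSpace (𝓡 (m + 1)) (C.proj u) →ₗ[ℝ] TangentSpace (𝓡 d) u :=
  Classical.epsilon fun g => ∀ v, C.dproj u (g v) = v

/-- `dT(ζ) + ω(ζ) T` at `u`, for `ζ ∈ T_u P`. When `T` is equivariant this vanishes for vertical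
`ζ`. -/
def tractorDeriv (T : P → Vec m) (u : P) (ζ : TangentSpace (𝓡 d) u) : Vec m :=
  let dT : Vec m := mfderiv (𝓡 d) 𝓘(ℝ, Vec m) T u ζ
  dT + (C.omega u ζ : Mat m) *ᵥ T u

/-- The tractor connection: for `w ∈ T_x N` and `u` over `x`, the derivative of the section `T` of
`𝒯` along `w` is `[u, dT(ζ) + ω(ζ) T(u)]` for any lift `ζ` of `w` to `T_u P`. (For `ζ = T_x s · w`,
with a local section `s`, this is `[s(x), w(f) + ω(T_x s · w) f(x)]`, where `f = T ∘ s`.) -/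
def tractorConn (T : P → Vec m) (u : P) (w : TangentSpace (𝓡 (m + 1)) (C.proj u)) : Vec m :=
  C.tractorDeriv T u (C.lift u w)

/-- The distinguished section `ξ = [u, ℓ]` of `𝒯`. -/
def xi : P → Vec m := fun _ => vecL m

/-- The map `Φ = ∇^𝒯 ξ : TN → 𝒯`. -/
def Phi (u : P) (w : TangentSpace (𝓡 (m + 1)) (C.proj u)) : Vec m :=
  C.tractorConn (xi (m := m) (P := P)) u w

/-- `η` is the lightlike section `η^τ` of `𝒯` with `𝐡(ξ, η) = 1` and `𝐡(Φ(An(τ)), η) = 0`. -/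
structure IsTransverse (τ : OneForm (m + 1) N) (η : P → Vec m) : Prop where
  isSection : C.IsTractorSection η
  null : ∀ u, lor (η u) (η u) = 0
  pairing : ∀ u, lor (vecL m) (η u) = 1
  orthogonal : ∀ u w, τ (C.proj u) w = 0 → lor (C.Phi u w) (η u) = 0

/-- The section `α ξ + Φ(X) + β η` of `𝒯`, that is, the column `(α, X, β)` in the splitting of `𝒯`
determined by `τ` when `η = η^τ`. -/
def column (η : P → Vec m) (α : N → ℝ) (X : VField (m + 1) N) (β : N → ℝ) : P → Vec m :=
  fun u => α (C.proj u) • vecL m + C.Phi u (X (C.proj u)) + β (C.proj u) • η u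

/-- In the splitting of `𝒯` determined by `τ`, the tractor connection takes the form
`∇^𝒯_W (α, X, β) = (W(α) + α τ(W) - h(X, D W), α P^τ(W) + β D W + ∇_W X, W(β) - β τ(W) - h(X, W))`
with the connection `cov` as `∇` and with the morphism `D`. -/
def IsTractorForm [IsManifold (𝓡 (m + 1)) ∞ N] (h : BilinField (m + 1) N) (Z : VField (m + 1) N)
    (τ : OneForm (m + 1) N) (η : P → Vec m)
    (cov : VField (m + 1) N → EndField (m + 1) N) (D : EndField (m + 1) N) : Prop :=
  ∀ (α β : N → ℝ) (X W : VField (m + 1) N), IsSmoothFun (n := m + 1) α →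
    IsSmoothFun (n := m + 1) β → X ∈ screenSections τ → IsSmoothField W → ∀ u : P,
    C.tractorConn (C.column η α X β) u (W (C.proj u))
      = C.column η
          (fun x => dirDeriv W α x + α x * τ x (W x) - h x (X x) (D x (W x)))
          (fun x => α x • screenProj Z τ x (W x) + β x • D x (W x) + cov X x (W x))
          (fun x => dirDeriv W β x - β x * τ x (W x) - h x (X x) (W x)) u

end LightlikeCartanGeometry

end LightlikeCartan

end

/-!
Everything is read off from the derivative `Φ = ∇^𝒯 ξ` of the distinguished tractor section. For
`ζ ∈ T_u P` over `w ∈ T_x N` one has `Φ(w) = [u, ω(ζ) ℓ]`, since `ξ` is represented by the constant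
function `ℓ`. Skew-symmetry of `ω(ζ)` puts `Φ(w)` into `ξ^⊥`, and `Φ : TN → ξ^⊥` is an isomorphism:
the fundamental vector fields show that `ω⁻¹(𝔥)` consists of vertical vectors, and since `ω` is an
isomorphism, a count of dimensions shows that it contains all of them (`ker_omegaMod`).
The same fundamental fields show that the tractor derivative of an equivariant function vanishes on
vertical vectors (`exists_fundamental`), so that `∇^𝒯` does not depend on the lifts. Then `h^ω` is
the pullback of `𝐡` by `Φ`, and `Z^ω = Φ⁻¹(ξ)`.

A lightlike vector `η` with `⟨ℓ, η⟩ = 1` is determined by its products with `ℓ^⊥`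
(`null_vec_unique`), and `η^τ` is the one with `𝐡(Φ(w), η^τ) = τ(w)` (`lor_Phi_eta`, `eq_eta`).
With the projection `scr` to the complement of `span(ξ, η^τ)`, the connection and the morphism are
defined by `Φ(∇^τ_W X) = scr (∇^𝒯_W Φ(X))` and `Φ(D^τ W) = scr (∇^𝒯_W η^τ)`. The remaining
components of these derivatives follow by differentiating the constant products of `ξ`, `Φ(X)` and
`η^τ`, because `∇^𝒯` is metric (`tractorConn_eta`, `tractorConn_PhiSec`).

For two forms, `h^ω(L, v) = τ(v) - τ̄(v)` for `L = L_{τ,τ̄}`, whence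
`η^τ = η^τ̄ + Φ(L) - ½ h^ω(L, L) ξ` (`eta_eq`). The transformation formulas are the `τ̄`-screen parts
of the derivatives of `Φ(P^τ̄ X) = Φ(X) - τ̄(X) ξ` and of this expression for `η^τ`.

Smoothness rests on two facts: in terms of a local section of `P`, the tractor derivative along a
smooth family of tangent vectors is smooth (`contMDiffAt_tractorConn`), and a family of tangent
vectors is smooth as soon as its image under `Φ` is (`contMDiffAt_of_Phi`).
-/

noncomputable section

namespace LightlikeCartan

section Model

variable {m : ℕ}

/-! ### Linear algebra of the model -/

theorem lor_apply (v w : Vec m) :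
    lor v w = v (iL m) * w (iN m) + v (iN m) * w (iL m) + ∑ i : Fin m, v (iE i) * w (iE i) := by
  simp [lor, dotProduct, Matrix.mulVec, gram, Fintype.sum_sum_type, Finset.sum_ite_eq]
  ring

theorem lor_comm (v w : Vec m) : lor v w = lor w v := by
  simp only [lor_apply, mul_comm]; ring

theorem lor_add_left (v v' w : Vec m) : lor (v + v') w = lor v w + lor v' w := by
  simp [lor, add_dotProduct]

theorem lor_sub_left (v v' w : Vec m) : lor (v - v') w = lor v w - lor v' w := by
  simp [lor, sub_dotProduct]

theorem lor_smul_left (c : ℝ) (v w : Vec m) : lor (c • v) w = c * lor v w := by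
  simp [lor]

theorem lor_add_right (v w w' : Vec m) : lor v (w + w') = lor v w + lor v w' := by
  simp only [lor_comm v, lor_add_left]

theorem lor_sub_right (v w w' : Vec m) : lor v (w - w') = lor v w - lor v w' := by
  simp only [lor_comm v, lor_sub_left]

theorem lor_smul_right (c : ℝ) (v w : Vec m) : lor v (c • w) = c * lor v w := by
  simp only [lor_comm v, lor_smul_left]

theorem lor_vecL_left (v : Vec m) : lor (vecL m) v = v (iN m) := by
  rw [lor_comm, lor_vecL]

theorem vecL_iN : vecL m (iN m) = 0 := by simp [vecL]

theorem vecL_iL : vecL m (iL m) = 1 := by simp [vecL]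

theorem vecL_iE (i : Fin m) : vecL m (iE i) = 0 := by simp [vecL]

theorem vec_ext {v w : Vec m} (hL : v (iL m) = w (iL m)) (hE : ∀ i, v (iE i) = w (iE i))
    (hN : v (iN m) = w (iN m)) : v = w := by
  ext j
  rcases j with _ | j | _
  exacts [hL, hE j, hN]

/-- A lightlike vector `η` with `⟨ℓ, η⟩ = 1` is determined by its products with `ℓ^⊥`: the
difference of two such vectors is a multiple of `ℓ`, which nullity forces to vanish. -/
theorem null_vec_unique {η η' : Vec m} (h0 : lor η η = 0) (h0' : lor η' η' = 0)
    (h1 : lor (vecL m) η = 1) (h1' : lor (vecL m) η' = 1)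
    (h : ∀ v : Vec m, v (iN m) = 0 → lor v η = lor v η') : η = η' := by
  have hE : ∀ i, η (iE i) = η' (iE i) := by
    intro i
    have := h (Pi.single (iE i) 1) (by simp)
    simpa [lor_apply, Pi.single_apply] using this
  rw [lor_vecL_left] at h1 h1'
  rw [lor_self, h1] at h0
  rw [lor_self, h1'] at h0'
  simp only [hE] at h0
  exact vec_ext (by linarith) hE (by rw [h1, h1'])

/-- The projection of `v` to the orthogonal complement of the hyperbolic plane spanned by `ℓ` and
`η`. -/
def scr (η v : Vec m) : Vec m := v - lor v η • vecL m - lor v (vecL m) • η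

theorem scr_add (η v w : Vec m) : scr η (v + w) = scr η v + scr η w := by
  simp only [scr, lor_add_left, add_smul]; abel

theorem scr_smul (c : ℝ) (η v : Vec m) : scr η (c • v) = c • scr η v := by
  simp only [scr, lor_smul_left, mul_smul, smul_sub]

theorem scr_sub (η v w : Vec m) : scr η (v - w) = scr η v - scr η w := by
  simp only [scr, lor_sub_left, sub_smul]; abel

theorem scr_iN {η : Vec m} (h1 : lor (vecL m) η = 1) (v : Vec m) : scr η v (iN m) = 0 := by
  rw [lor_vecL_left] at h1
  simp [scr, h1, vecL_iN, lor_vecL]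

theorem lor_scr {η : Vec m} (h0 : lor η η = 0) (h1 : lor (vecL m) η = 1) (v : Vec m) :
    lor (scr η v) η = 0 := by
  simp [scr, lor_sub_left, lor_smul_left, h0, h1]

theorem scr_vecL {η : Vec m} (h1 : lor (vecL m) η = 1) : scr η (vecL m) = 0 := by
  simp [scr, h1, lor_vecL, vecL_iN]

theorem scr_self {η : Vec m} (h0 : lor η η = 0) (h1 : lor (vecL m) η = 1) : scr η η = 0 := by
  simp [scr, h0, lor_comm η (vecL m), h1]

theorem scr_of_iN_eq_zero (η : Vec m) {v : Vec m} (hv : v (iN m) = 0) :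
    scr η v = v - lor v η • vecL m := by
  simp [scr, lor_vecL, hv]

theorem eq_scr_add (η v : Vec m) :
    v = lor v η • vecL m + scr η v + lor v (vecL m) • η := by
  simp only [scr]; abel

theorem matH_mul (a b : grpH m) : matH (a * b) = matH a * matH b := rfl

theorem matH_mul_inv (a : grpH m) : matH a * matH a⁻¹ = 1 := by
  rw [← matH_mul, mul_inv_cancel]; rfl

theorem matH_isometry (a : grpH m) : (matH a)ᵀ * gram m * matH a = gram m := a.2.1.1

theorem matH_mulVec_vecL (a : grpH m) : matH a *ᵥ vecL m = vecL m := a.2.2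

theorem lor_matH (a : grpH m) (v w : Vec m) : lor (matH a *ᵥ v) (matH a *ᵥ w) = lor v w :=
  lor_mulVec (matH_isometry a) v w

theorem matH_mulVec_iN (a : grpH m) (v : Vec m) : (matH a *ᵥ v) (iN m) = v (iN m) := by
  rw [← lor_vecL v, ← lor_vecL (matH a *ᵥ v), ← lor_matH a v, matH_mulVec_vecL]

theorem scr_matH (a : grpH m) (η v : Vec m) :
    scr (matH a *ᵥ η) (matH a *ᵥ v) = matH a *ᵥ scr η v := by
  have h : lor (matH a *ᵥ v) (vecL m) = lor v (vecL m) := by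
    rw [lor_vecL, lor_vecL, matH_mulVec_iN]
  simp only [scr, lor_matH, h, Matrix.mulVec_sub, Matrix.mulVec_smul, matH_mulVec_vecL]

/-- The inverse of an isometry is its adjoint; in particular it depends polynomially on the
entries. -/
theorem matH_inv (a : grpH m) : matH a⁻¹ = gram m * (matH a)ᵀ * gram m := by
  have h : gram m * (matH a)ᵀ * gram m * matH a = 1 := by
    rw [Matrix.mul_assoc, Matrix.mul_assoc, ← Matrix.mul_assoc _ (gram m), matH_isometry,
      gram_mul_gram]
  calc matH a⁻¹ = (gram m * (matH a)ᵀ * gram m * matH a) * matH a⁻¹ := by rw [h, Matrix.one_mul]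
    _ = _ := by rw [Matrix.mul_assoc, matH_mul_inv, Matrix.mul_one]

theorem entries_injective : Function.Injective (entries (m := m)) := by
  intro a b h
  apply Subtype.ext
  apply Units.ext
  ext i j
  exact congrFun (congrFun h i) j

theorem ofEntries_entries (a : grpH m) : ofEntries (entries a) = a :=
  Function.leftInverse_invFun entries_injective a

theorem lor_lieG {A : Mat m} (hA : A ∈ lieG m) (v w : Vec m) :
    lor (A *ᵥ v) w + lor v (A *ᵥ w) = 0 := by
  have hA' : Aᵀ * gram m + gram m * A = 0 := hA
  have h : lor (A *ᵥ v) w = v ⬝ᵥ ((Aᵀ * gram m) *ᵥ w) := by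
    rw [lor, ← Matrix.vecMul_transpose, ← Matrix.dotProduct_mulVec, Matrix.mulVec_mulVec]
  rw [h, lor, Matrix.mulVec_mulVec, ← dotProduct_add, ← Matrix.add_mulVec, hA',
    Matrix.zero_mulVec, dotProduct_zero]

theorem lieG_mulVec_vecL_iN {A : Mat m} (hA : A ∈ lieG m) : (A *ᵥ vecL m) (iN m) = 0 := by
  have := lor_lieG hA (vecL m) (vecL m)
  rw [lor_vecL, lor_vecL_left] at this
  linarith

theorem mulVec_vecL (A : Mat m) (i : Idx m) : (A *ᵥ vecL m) i = A i (iL m) := by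
  simp [vecL]

/-- The projection `𝕃^{m+2} → ℝ × ℝᵐ` along `n`, which identifies `ℓ^⊥` with `ℝ × ℝᵐ`. -/
def toLE : Vec m →ₗ[ℝ] ℝ × (Fin m → ℝ) where
  toFun v := (v (iL m), fun i => v (iE i))
  map_add' _ _ := rfl
  map_smul' _ _ := rfl

theorem toLE_mulVec_vecL (A : Mat m) : toLE (A *ᵥ vecL m) = modH A := by
  simp [toLE, modH, mulVec_vecL]

theorem toLE_injOn {v w : Vec m} (hv : v (iN m) = 0) (hw : w (iN m) = 0)
    (h : toLE v = toLE w) : v = w :=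
  vec_ext (congrArg Prod.fst h) (fun i => congrFun (congrArg Prod.snd h) i) (by rw [hv, hw])

theorem lor_of_iN_eq_zero {v w : Vec m} (hv : v (iN m) = 0) (hw : w (iN m) = 0) :
    lor v w = ∑ i : Fin m, v (iE i) * w (iE i) := by
  rw [lor_apply, hv, hw]; ring

end Model

namespace LightlikeCartanGeometry

variable {m d : ℕ}
  {N : Type*} [TopologicalSpace N] [ChartedSpace (EuclideanSpace ℝ (Fin (m + 1))) N]
  {P : Type*} [TopologicalSpace P] [ChartedSpace (EuclideanSpace ℝ (Fin d)) P]
  [IsManifold (𝓡 d) ∞ P]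
  (C : LightlikeCartanGeometry m d N P)

/-! ### Vertical vectors and the isomorphism `Φ` -/

instance {n : ℕ} {M : Type*} [TopologicalSpace M] [ChartedSpace (EuclideanSpace ℝ (Fin n)) M]
    (x : M) : FiniteDimensional ℝ (TangentSpace (𝓡 n) x) :=
  inferInstanceAs (FiniteDimensional ℝ (EuclideanSpace ℝ (Fin n)))

instance {n : ℕ} {M : Type*} [TopologicalSpace M] [ChartedSpace (EuclideanSpace ℝ (Fin n)) M]
    (x : M) : T2Space (TangentSpace (𝓡 n) x) :=
  inferInstanceAs (T2Space (EuclideanSpace ℝ (Fin n)))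

theorem finrank_tangentSpace {n : ℕ} {M : Type*} [TopologicalSpace M]
    [ChartedSpace (EuclideanSpace ℝ (Fin n)) M] (x : M) :
    Module.finrank ℝ (TangentSpace (𝓡 n) x) = n :=
  (finrank_euclideanSpace_fin : Module.finrank ℝ (EuclideanSpace ℝ (Fin n)) = n)


theorem proj_surjective : Function.Surjective C.proj := fun x => by
  obtain ⟨U, -, hx, s, -, -, -, hs, -⟩ := C.locally_trivial x
  exact ⟨s x, hs x hx⟩

theorem contMDiff_act_right (a : grpH m) : ContMDiff (𝓡 d) (𝓡 d) ∞ (fun w => C.act w a) := by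
  have h : ContMDiff (𝓡 d) ((𝓡 d).prod 𝓘(ℝ, Idx m → Idx m → ℝ)) ∞
      (fun w : P => (w, entries a)) := contMDiff_id.prodMk contMDiff_const
  have := C.contMDiff_act.comp_contMDiff h (fun w => ⟨trivial, a, rfl⟩)
  simpa [Function.comp_def, ofEntries_entries] using this

omit [IsManifold (𝓡 d) ∞ P] in
theorem mfderiv_eq_of_eq {f g : P → N} (hfg : f = g) (u : P) (ζ : TangentSpace (𝓡 d) u)
    (W : VField (m + 1) N) (h : mfderiv (𝓡 d) (𝓡 (m + 1)) f u ζ = W (f u)) :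
    mfderiv (𝓡 d) (𝓡 (m + 1)) g u ζ = W (g u) := by
  subst hfg; exact h

/-- The right translations cover the identity of `N`. Tangent vectors at the equal points `proj u`
and `proj (act u a)`, whose tangent spaces are distinct types, are matched as values of one vector
field `W`, on which no regularity is imposed. -/
theorem dproj_mfderiv_act (u : P) (a : grpH m) (ζ : TangentSpace (𝓡 d) u) (W : VField (m + 1) N)
    (h : C.dproj u ζ = W (C.proj u)) :
    C.dproj (C.act u a) (mfderiv (𝓡 d) (𝓡 d) (fun w => C.act w a) u ζ)
      = W (C.proj (C.act u a)) := by
  have hf : C.proj = C.proj ∘ (fun w => C.act w a) := by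
    funext w; exact (C.proj_act w a).symm
  have h1 := mfderiv_eq_of_eq hf u ζ W h
  rw [mfderiv_comp u ((C.contMDiff_proj _).mdifferentiableAt (by simp))
    ((C.contMDiff_act_right a u).mdifferentiableAt (by simp))] at h1
  exact h1

/-- The derivative of a local section of `P` lifts tangent vectors of `N`. -/
theorem dproj_mfderiv_section {U : Set N} (hU : IsOpen U) {s : N → P}
    (hs : ContMDiffOn (𝓡 (m + 1)) (𝓡 d) ∞ s U) (hps : ∀ y ∈ U, C.proj (s y) = y) {x : N}
    (hx : x ∈ U) (W : VField (m + 1) N) :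
    C.dproj (s x) (mfderiv (𝓡 (m + 1)) (𝓡 d) s x (W x)) = W (C.proj (s x)) := by
  have hsx : MDifferentiableAt (𝓡 (m + 1)) (𝓡 d) s x :=
    (hs.contMDiffAt (hU.mem_nhds hx)).mdifferentiableAt (by simp)
  have hpx : MDifferentiableAt (𝓡 d) (𝓡 (m + 1)) C.proj (s x) :=
    (C.contMDiff_proj _).mdifferentiableAt (by simp)
  have h1 := hpx.hasMFDerivAt.comp x hsx.hasMFDerivAt
  have h2 : HasMFDerivAt (𝓡 (m + 1)) (𝓡 (m + 1)) (C.proj ∘ s) x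
      (ContinuousLinearMap.id ℝ (TangentSpace (𝓡 (m + 1)) x)) := by
    refine (hasMFDerivAt_id x).congr_of_eventuallyEq ?_
    filter_upwards [hU.mem_nhds hx] with y hy
    exact hps y hy
  have h3 : C.dproj (s x) (mfderiv (𝓡 (m + 1)) (𝓡 d) s x (W x)) = W x :=
    congrArg (fun L => L (W x)) (hasMFDerivAt_unique h1 h2)
  have hE : ∀ y, y = x → (W x : EuclideanSpace ℝ (Fin (m + 1))) = W y := by
    rintro y rfl; rfl
  exact h3.trans (hE _ (hps x hx))

theorem exists_dproj_eq (u : P) (W : VField (m + 1) N) : ∃ ζ, C.dproj u ζ = W (C.proj u) := by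
  obtain ⟨U, hU, hx, s, ψ, hs, -, hps, hu⟩ := C.locally_trivial (C.proj u)
  have h := C.dproj_mfderiv_act _ (ψ u) _ W (C.dproj_mfderiv_section hU hs hps hx W)
  rw [hu u hx] at h
  exact ⟨_, h⟩

theorem dproj_surjective (u : P) : Function.Surjective (C.dproj u) := fun w =>
  C.exists_dproj_eq u (fun _ => w)

theorem dproj_lift (u : P) (w : TangentSpace (𝓡 (m + 1)) (C.proj u)) :
    C.dproj u (C.lift u w) = w := by
  have hex : ∃ g : TangentSpace (𝓡 (m + 1)) (C.proj u) →ₗ[ℝ] TangentSpace (𝓡 d) u,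
      ∀ v, C.dproj u (g v) = v := by
    obtain ⟨g, hg⟩ := LinearMap.exists_rightInverse_of_surjective (C.dproj u).toLinearMap
      (LinearMap.range_eq_top.2 (C.dproj_surjective u))
    exact ⟨g, fun v => LinearMap.congr_fun hg v⟩
  exact Classical.epsilon_spec hex w

theorem expH_zero_smul (A : lieH m) : expH ((0 : ℝ) • A) = 1 := by
  apply Subtype.ext
  apply Units.ext
  show NormedSpace.exp (((0 : ℝ) • A : lieH m) : Mat m) = 1
  simp

theorem tractorDeriv_add (T : P → Vec m) (u : P) (ζ ζ' : TangentSpace (𝓡 d) u) :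
    C.tractorDeriv T u (ζ + ζ') = C.tractorDeriv T u ζ + C.tractorDeriv T u ζ' := by
  simp only [tractorDeriv, map_add, Submodule.coe_add, Matrix.add_mulVec]
  exact add_add_add_comm _ _ _ _

theorem tractorDeriv_smul (T : P → Vec m) (u : P) (c : ℝ) (ζ : TangentSpace (𝓡 d) u) :
    C.tractorDeriv T u (c • ζ) = c • C.tractorDeriv T u ζ := by
  simp only [tractorDeriv, map_smul, Submodule.coe_smul, Matrix.smul_mulVec]
  exact (smul_add c _ _).symm

theorem tractorDeriv_sub (T : P → Vec m) (u : P) (ζ ζ' : TangentSpace (𝓡 d) u) :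
    C.tractorDeriv T u (ζ - ζ') = C.tractorDeriv T u ζ - C.tractorDeriv T u ζ' := by
  have h := C.tractorDeriv_add T u (ζ - ζ') ζ'
  rw [sub_add_cancel] at h
  rw [h, add_sub_cancel_right]

theorem matH_expH_inv (A : lieH m) : matH (expH A)⁻¹ = NormedSpace.exp (-(A : Mat m)) := by
  have hdet : IsUnit (NormedSpace.exp (A : Mat m)).det :=
    (Matrix.isUnit_iff_isUnit_det _).1 (Matrix.isUnit_exp (A : Mat m))
  have h : NormedSpace.exp (-(A : Mat m)) * matH (expH A) = 1 := by
    rw [Matrix.exp_neg]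
    exact Matrix.nonsing_inv_mul (NormedSpace.exp (A : Mat m)) hdet
  rw [← Matrix.one_mul (matH (expH A)⁻¹), ← h, Matrix.mul_assoc, matH_mul_inv, Matrix.mul_one]

theorem hasDerivAt_clm_exp_neg {𝔸 F : Type*} [NormedRing 𝔸] [NormedAlgebra ℝ 𝔸] [CompleteSpace 𝔸]
    [NormedAddCommGroup F] [NormedSpace ℝ F] (L : 𝔸 →L[ℝ] F) (x : 𝔸) :
    HasDerivAt (fun t : ℝ => L (NormedSpace.exp (-(t • x)))) (-(L x)) 0 := by
  have h : HasDerivAt (fun t : ℝ => NormedSpace.exp (-(t • x))) (-x) 0 := by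
    simpa using hasDerivAt_exp_smul_const (𝕂 := ℝ) (-x) 0
  have h' := L.hasFDerivAt.comp_hasDerivAt (0 : ℝ) h
  rwa [map_neg] at h'

open scoped Matrix.Norms.Operator in
theorem hasDerivAt_exp_neg_mulVec (A : Mat m) (v : Vec m) :
    HasDerivAt (fun t : ℝ => NormedSpace.exp (-(t • A)) *ᵥ v) (-(A *ᵥ v)) 0 :=
  hasDerivAt_clm_exp_neg (LinearMap.toContinuousLinearMap
    { toFun := fun B : Mat m => B *ᵥ v
      map_add' := fun B B' => Matrix.add_mulVec B B' v
      map_smul' := fun c B => Matrix.smul_mulVec c B v }) A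

/-- Fundamental vector fields are vertical, and tractor sections are parallel along them: the
derivative of the equivariant function `T` along `ζ_A` is `-A T`. -/
theorem exists_fundamental (u : P) (A : lieH m) :
    ∃ ζ : TangentSpace (𝓡 d) u, (C.omega u ζ : Mat m) = A ∧ C.dproj u ζ = 0 ∧
      ∀ T : P → Vec m, C.IsTractorSection T → C.tractorDeriv T u ζ = 0 := by
  set γ : ℝ → P := fun t => C.act u (expH (t • A)) with hγ
  have hu : γ 0 = u := by
    show C.act u (expH ((0 : ℝ) • A)) = u
    rw [expH_zero_smul, C.act_one]
  suffices h : ∃ ζ : TangentSpace (𝓡 d) (γ 0), (C.omega (γ 0) ζ : Mat m) = A ∧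
      C.dproj (γ 0) ζ = 0 ∧
      ∀ T : P → Vec m, C.IsTractorSection T → C.tractorDeriv T (γ 0) ζ = 0 by
    rwa [hu] at h
  -- If the orbit `γ` were not differentiable at `0`, its `mfderiv` would be the junk value `0`, and
  -- both claims would hold trivially; so differentiability need not be proved.
  refine ⟨mfderiv 𝓘(ℝ, ℝ) (𝓡 d) γ 0 (1 : ℝ), C.omega_fundamental u A, ?_, fun T hT => ?_⟩
  · by_cases hd : MDifferentiableAt 𝓘(ℝ, ℝ) (𝓡 d) γ 0
    · have h1 := mfderiv_comp (0 : ℝ)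
        ((C.contMDiff_proj (γ 0)).mdifferentiableAt (by simp)) hd
      have h2 : C.proj ∘ γ = fun _ => C.proj u := by funext t; exact C.proj_act u _
      have h3 : C.dproj (γ 0) (mfderiv 𝓘(ℝ, ℝ) (𝓡 d) γ 0 (1 : ℝ))
          = mfderiv 𝓘(ℝ, ℝ) (𝓡 (m + 1)) (C.proj ∘ γ) 0 (1 : ℝ) := by rw [h1]; rfl
      rw [h3, h2, mfderiv_const]
      rfl
    · rw [mfderiv_zero_of_not_mdifferentiableAt hd]
      exact map_zero _
  · by_cases hd : MDifferentiableAt 𝓘(ℝ, ℝ) (𝓡 d) γ 0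
    · have h1 := mfderiv_comp (0 : ℝ) ((hT.smooth (γ 0)).mdifferentiableAt (by simp)) hd
      have h2 : T ∘ γ = fun t : ℝ => NormedSpace.exp (-(t • (A : Mat m))) *ᵥ T u := by
        funext t
        show T (C.act u (expH (t • A))) = _
        rw [hT.equivariant, matH_expH_inv]; rfl
      have h3 : mfderiv (𝓡 d) 𝓘(ℝ, Vec m) T (γ 0) (mfderiv 𝓘(ℝ, ℝ) (𝓡 d) γ 0 (1 : ℝ))
          = (-((A : Mat m) *ᵥ T u) : Vec m) := by
        have h4 : mfderiv (𝓡 d) 𝓘(ℝ, Vec m) T (γ 0) (mfderiv 𝓘(ℝ, ℝ) (𝓡 d) γ 0 (1 : ℝ))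
            = mfderiv 𝓘(ℝ, ℝ) 𝓘(ℝ, Vec m) (T ∘ γ) 0 (1 : ℝ) := by rw [h1]; rfl
        rw [h4, h2, (hasDerivAt_exp_neg_mulVec (A : Mat m) (T u)).hasFDerivAt.hasMFDerivAt.mfderiv]
        exact one_smul ℝ _
      unfold tractorDeriv
      rw [h3, C.omega_fundamental u A, hu]
      exact neg_add_cancel _
    · rw [mfderiv_zero_of_not_mdifferentiableAt hd]
      have := C.tractorDeriv_smul T (γ 0) 0 0
      rw [zero_smul, zero_smul] at this
      exact this

theorem finrank_ker_dproj (u : P) :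
    Module.finrank ℝ (LinearMap.ker (C.dproj u).toLinearMap) + (m + 1) = d := by
  have h := LinearMap.finrank_range_add_finrank_ker (C.dproj u).toLinearMap
  rw [LinearMap.range_eq_top.2 (C.dproj_surjective u), finrank_top, finrank_tangentSpace,
    finrank_tangentSpace] at h
  omega

/-- The linear map `ζ ↦ ω(ζ) + 𝔥` to `𝔤/𝔥 ≅ ℝ × ℝᵐ`. -/
def omegaMod (u : P) : TangentSpace (𝓡 d) u →ₗ[ℝ] ℝ × (Fin m → ℝ) where
  toFun ζ := modH (C.omega u ζ : Mat m)
  map_add' ζ ζ' := by rw [map_add]; rfl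
  map_smul' c ζ := by rw [map_smul]; rfl

theorem omegaMod_apply (u : P) (ζ : TangentSpace (𝓡 d) u) :
    C.omegaMod u ζ = toLE ((C.omega u ζ : Mat m) *ᵥ vecL m) := (toLE_mulVec_vecL _).symm

theorem omegaMod_eq_zero_iff (u : P) (ζ : TangentSpace (𝓡 d) u) :
    C.omegaMod u ζ = 0 ↔ (C.omega u ζ : Mat m) *ᵥ vecL m = 0 := by
  rw [omegaMod_apply]
  constructor
  · intro h
    exact toLE_injOn (lieG_mulVec_vecL_iN (C.omega u ζ).2) rfl (by rw [h, map_zero])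
  · intro h; rw [h, map_zero]

/-- The vertical vectors are those that `ω` maps into `𝔥`: fundamental fields give one inclusion,
and both spaces have codimension `m + 1`. -/
theorem ker_omegaMod (u : P) :
    LinearMap.ker (C.omegaMod u) = LinearMap.ker (C.dproj u).toLinearMap := by
  apply Submodule.eq_of_le_of_finrank_le
  · intro ζ hζ
    rw [LinearMap.mem_ker, omegaMod_eq_zero_iff] at hζ
    obtain ⟨ζ', h1, h2, -⟩ := C.exists_fundamental u ⟨_, (C.omega u ζ).2, hζ⟩
    have : ζ' = ζ := (C.omega_bijective u).1 (Subtype.ext h1)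
    rw [LinearMap.mem_ker, ← this]
    exact h2
  · have h := LinearMap.finrank_range_add_finrank_ker (C.omegaMod u)
    have h' := Submodule.finrank_le (LinearMap.range (C.omegaMod u))
    have h'' := C.finrank_ker_dproj u
    rw [finrank_tangentSpace] at h
    rw [Module.finrank_prod, Module.finrank_self, Module.finrank_fin_fun] at h'
    omega

theorem omega_vecL_of_vertical {u : P} {ζ : TangentSpace (𝓡 d) u} (h : C.dproj u ζ = 0) :
    (C.omega u ζ : Mat m) *ᵥ vecL m = 0 := by
  rw [← omegaMod_eq_zero_iff, ← LinearMap.mem_ker, ker_omegaMod]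
  exact h

theorem tractorDeriv_of_vertical {T : P → Vec m} (hT : C.IsTractorSection T) {u : P}
    {ζ : TangentSpace (𝓡 d) u} (h : C.dproj u ζ = 0) : C.tractorDeriv T u ζ = 0 := by
  obtain ⟨ζ', h1, -, h3⟩ :=
    C.exists_fundamental u ⟨_, (C.omega u ζ).2, C.omega_vecL_of_vertical h⟩
  have : ζ' = ζ := (C.omega_bijective u).1 (Subtype.ext h1)
  rw [← this]
  exact h3 T hT

/-- The tractor connection does not depend on the lift. -/
theorem tractorConn_dproj {T : P → Vec m} (hT : C.IsTractorSection T) (u : P)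
    (ζ : TangentSpace (𝓡 d) u) : C.tractorConn T u (C.dproj u ζ) = C.tractorDeriv T u ζ := by
  rw [tractorConn, ← sub_eq_zero, ← tractorDeriv_sub]
  apply C.tractorDeriv_of_vertical hT
  rw [map_sub, dproj_lift, sub_self]

theorem tractorConn_add_right (T : P → Vec m) (u : P) (v w : TangentSpace (𝓡 (m + 1)) (C.proj u)) :
    C.tractorConn T u (v + w) = C.tractorConn T u v + C.tractorConn T u w := by
  rw [tractorConn, map_add, tractorDeriv_add]; rfl

theorem tractorConn_smul_right (T : P → Vec m) (u : P) (c : ℝ)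
    (w : TangentSpace (𝓡 (m + 1)) (C.proj u)) :
    C.tractorConn T u (c • w) = c • C.tractorConn T u w := by
  rw [tractorConn, map_smul, tractorDeriv_smul]; rfl

theorem isTractorSection_xi : C.IsTractorSection xi where
  smooth := contMDiff_const
  equivariant _ a := (matH_mulVec_vecL a⁻¹).symm

theorem tractorDeriv_xi (u : P) (ζ : TangentSpace (𝓡 d) u) :
    C.tractorDeriv xi u ζ = (C.omega u ζ : Mat m) *ᵥ vecL m := by
  unfold tractorDeriv xi
  rw [mfderiv_const]
  exact zero_add _

theorem Phi_dproj (u : P) (ζ : TangentSpace (𝓡 d) u) :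
    C.Phi u (C.dproj u ζ) = (C.omega u ζ : Mat m) *ᵥ vecL m := by
  rw [Phi, C.tractorConn_dproj C.isTractorSection_xi, tractorDeriv_xi]

theorem Phi_iN (u : P) (w : TangentSpace (𝓡 (m + 1)) (C.proj u)) : C.Phi u w (iN m) = 0 := by
  rw [← C.dproj_lift u w, Phi_dproj]
  exact lieG_mulVec_vecL_iN (C.omega u _).2

/-- `Φ` in the identification of `ℓ^⊥` with `ℝ × ℝᵐ`, that is, the isomorphism `φ_u`. -/
def phi (u : P) : TangentSpace (𝓡 (m + 1)) (C.proj u) →ₗ[ℝ] ℝ × (Fin m → ℝ) where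
  toFun w := toLE (C.Phi u w)
  map_add' _ _ := by rw [Phi, tractorConn_add_right, map_add]; rfl
  map_smul' _ _ := by rw [Phi, tractorConn_smul_right, map_smul]; rfl

theorem phi_injective (u : P) : Function.Injective (C.phi u) := by
  rw [← LinearMap.ker_eq_bot, LinearMap.ker_eq_bot']
  intro w hw
  obtain ⟨ζ, rfl⟩ := C.dproj_surjective u w
  have h : C.omegaMod u ζ = 0 := by
    rw [omegaMod_apply, ← Phi_dproj]
    exact hw
  rw [← LinearMap.mem_ker, ker_omegaMod] at h
  exact h

/-- The isomorphism `φ_u : T_x N → 𝔤/𝔥`. -/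
def phiEquiv (u : P) : TangentSpace (𝓡 (m + 1)) (C.proj u) ≃ₗ[ℝ] ℝ × (Fin m → ℝ) :=
  LinearEquiv.ofInjectiveOfFinrankEq (C.phi u) (C.phi_injective u) (by
    rw [finrank_tangentSpace, Module.finrank_prod, Module.finrank_self, Module.finrank_fin_fun]
    omega)

theorem phiEquiv_apply (u : P) (w : TangentSpace (𝓡 (m + 1)) (C.proj u)) :
    C.phiEquiv u w = toLE (C.Phi u w) := rfl

theorem Phi_injective (u : P) : Function.Injective (C.Phi u) := fun _ _ h =>
  C.phi_injective u (congrArg toLE h)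

/-- The inverse of `Φ`, extended to `𝕃^{m+2}` by zero on `n`. -/
def PhiInv (u : P) : Vec m →ₗ[ℝ] TangentSpace (𝓡 (m + 1)) (C.proj u) :=
  (C.phiEquiv u).symm.toLinearMap ∘ₗ toLE

theorem Phi_PhiInv (u : P) {v : Vec m} (hv : v (iN m) = 0) : C.Phi u (C.PhiInv u v) = v := by
  apply toLE_injOn (C.Phi_iN u _) hv
  rw [← phiEquiv_apply, PhiInv, LinearMap.comp_apply]
  exact (C.phiEquiv u).apply_symm_apply _

theorem Phi_add (u : P) (v w : TangentSpace (𝓡 (m + 1)) (C.proj u)) :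
    C.Phi u (v + w) = C.Phi u v + C.Phi u w := C.tractorConn_add_right _ u v w

theorem Phi_smul (u : P) (c : ℝ) (w : TangentSpace (𝓡 (m + 1)) (C.proj u)) :
    C.Phi u (c • w) = c • C.Phi u w := C.tractorConn_smul_right _ u c w

theorem Phi_sub (u : P) (v w : TangentSpace (𝓡 (m + 1)) (C.proj u)) :
    C.Phi u (v - w) = C.Phi u v - C.Phi u w := by
  have h := C.Phi_add u (v - w) w
  rw [sub_add_cancel] at h
  rw [h, add_sub_cancel_right]

/-! ### Equivariance -/

omit [IsManifold (𝓡 d) ∞ P] in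
theorem mfderiv_mulVec {T : P → Vec m} {u : P} (hT : MDifferentiableAt (𝓡 d) 𝓘(ℝ, Vec m) T u)
    (B : Mat m) (ζ : TangentSpace (𝓡 d) u) :
    (mfderiv (𝓡 d) 𝓘(ℝ, Vec m) (fun w => B *ᵥ T w) u ζ : Vec m)
      = B *ᵥ (mfderiv (𝓡 d) 𝓘(ℝ, Vec m) T u ζ : Vec m) := by
  let L : Vec m →L[ℝ] Vec m := LinearMap.toContinuousLinearMap (Matrix.mulVecLin B)
  have h : HasMFDerivAt (𝓡 d) 𝓘(ℝ, Vec m) (L ∘ T) u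
      (L.comp (mfderiv (𝓡 d) 𝓘(ℝ, Vec m) T u)) :=
    HasMFDerivAt.comp u L.hasMFDerivAt hT.hasMFDerivAt
  exact congrArg (fun M => M ζ) h.mfderiv

theorem tractorDeriv_act {T : P → Vec m} (hT : C.IsTractorSection T) (u : P) (a : grpH m)
    (ζ : TangentSpace (𝓡 d) u) :
    C.tractorDeriv T (C.act u a) (mfderiv (𝓡 d) (𝓡 d) (fun w => C.act w a) u ζ)
      = matH a⁻¹ *ᵥ C.tractorDeriv T u ζ := by
  have hd : ∀ v, MDifferentiableAt (𝓡 d) 𝓘(ℝ, Vec m) T v := fun v =>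
    (hT.smooth v).mdifferentiableAt (by simp)
  have h1 := mfderiv_comp u (hd (C.act u a))
    ((C.contMDiff_act_right a u).mdifferentiableAt (by simp))
  have h2 : T ∘ (fun w => C.act w a) = fun w => matH a⁻¹ *ᵥ T w := by
    funext w; exact hT.equivariant w a
  have h3 : (mfderiv (𝓡 d) 𝓘(ℝ, Vec m) T (C.act u a)
      (mfderiv (𝓡 d) (𝓡 d) (fun w => C.act w a) u ζ) : Vec m)
      = matH a⁻¹ *ᵥ (mfderiv (𝓡 d) 𝓘(ℝ, Vec m) T u ζ : Vec m) := by
    rw [← mfderiv_mulVec (hd u), ← h2, h1]; rfl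
  unfold tractorDeriv
  rw [h3, C.omega_equivariant, hT.equivariant, Matrix.mulVec_mulVec, Matrix.mul_assoc,
    matH_mul_inv, Matrix.mul_one, ← Matrix.mulVec_mulVec]
  exact (Matrix.mulVec_add _ _ _).symm

theorem tractorConn_eq {T : P → Vec m} (hT : C.IsTractorSection T) {u : P}
    {ζ : TangentSpace (𝓡 d) u} {w : TangentSpace (𝓡 (m + 1)) (C.proj u)}
    (h : C.dproj u ζ = w) : C.tractorConn T u w = C.tractorDeriv T u ζ := by
  rw [← h, C.tractorConn_dproj hT]

theorem tractorConn_act {T : P → Vec m} (hT : C.IsTractorSection T) (u : P) (a : grpH m)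
    (W : VField (m + 1) N) :
    C.tractorConn T (C.act u a) (W (C.proj (C.act u a)))
      = matH a⁻¹ *ᵥ C.tractorConn T u (W (C.proj u)) := by
  obtain ⟨ζ, hζ⟩ := C.exists_dproj_eq u W
  rw [C.tractorConn_eq hT (C.dproj_mfderiv_act u a ζ W hζ), C.tractorConn_eq hT hζ,
    C.tractorDeriv_act hT]

theorem Phi_act (u : P) (a : grpH m) (W : VField (m + 1) N) :
    C.Phi (C.act u a) (W (C.proj (C.act u a))) = matH a⁻¹ *ᵥ C.Phi u (W (C.proj u)) :=
  C.tractorConn_act C.isTractorSection_xi u a W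

/-! ### Smoothness -/

section Smoothness

variable {E' H' M' : Type*} [NormedAddCommGroup E'] [NormedSpace ℝ E'] [TopologicalSpace H']
  {I' : ModelWithCorners ℝ E' H'} [TopologicalSpace M'] [ChartedSpace H' M']

theorem contMDiff_omega_entries : ContMDiff (𝓡 d).tangent 𝓘(ℝ, Idx m → Idx m → ℝ) ∞
    (fun v : TangentBundle (𝓡 d) P => fun i j => (C.omega v.1 v.2 : Mat m) i j) :=
  contMDiff_pi_space.2 fun i => contMDiff_pi_space.2 fun j => C.contMDiff_omega i j

theorem contMDiff_deriv_vec {T : P → Vec m}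
    (hT : ContMDiff (𝓡 d) 𝓘(ℝ, Vec m) ∞ T) :
    ContMDiff (𝓡 d).tangent 𝓘(ℝ, Vec m) ∞
      (fun v : TangentBundle (𝓡 d) P => (mfderiv (𝓡 d) 𝓘(ℝ, Vec m) T v.1 v.2 : Vec m)) :=
  (contMDiff_snd_tangentBundle_modelSpace (Vec m) 𝓘(ℝ, Vec m)).comp (hT.contMDiff_tangentMap (m := ∞) (by simp))

theorem contDiff_mulVec_entries : ContDiff ℝ ∞
    (fun p : (Idx m → Idx m → ℝ) × Vec m => (Matrix.of p.1 : Mat m) *ᵥ p.2) := by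
  refine contDiff_pi.2 fun i => ?_
  show ContDiff ℝ ∞ (fun p : (Idx m → Idx m → ℝ) × Vec m => ∑ j, p.1 i j * p.2 j)
  fun_prop

theorem contDiff_inv_mulVec_entries : ContDiff ℝ ∞
    (fun p : (Idx m → Idx m → ℝ) × Vec m =>
      (gram m * (Matrix.of p.1 : Mat m)ᵀ * gram m) *ᵥ p.2) := by
  refine contDiff_pi.2 fun i => ?_
  simp only [Matrix.mulVec, dotProduct, Matrix.mul_apply, Matrix.transpose_apply]
  show ContDiff ℝ ∞ (fun p : (Idx m → Idx m → ℝ) × Vec m =>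
    ∑ j, (∑ k, (∑ l, gram m i l * p.1 k l) * gram m k j) * p.2 j)
  fun_prop

theorem contMDiff_tractorDeriv {T : P → Vec m} (hT : ContMDiff (𝓡 d) 𝓘(ℝ, Vec m) ∞ T) :
    ContMDiff (𝓡 d).tangent 𝓘(ℝ, Vec m) ∞
      (fun v : TangentBundle (𝓡 d) P => C.tractorDeriv T v.1 v.2) := by
  have h1 := C.contMDiff_omega_entries.prodMk_space
    (hT.comp (Bundle.contMDiff_proj (TangentSpace (𝓡 d) (M := P))))
  exact (contMDiff_deriv_vec hT).add (contDiff_mulVec_entries.contMDiff.comp h1)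

variable [IsManifold (𝓡 (m + 1)) ∞ N]

/-- The covariant derivative of a smooth tractor section along a smooth family of tangent vectors
of `N` is smooth. In terms of a local section `s` and `u = s(x) a`, it is
`a⁻¹ (dT(ζ) + ω(ζ) T(s(x)))` for the lift `ζ` given by the derivative of `s`. -/
theorem contMDiffAt_tractorConn {T : P → Vec m} (hT : C.IsTractorSection T) {g : M' → P}
    {Y : ∀ z, TangentSpace (𝓡 (m + 1)) (C.proj (g z))} {z₀ : M'}
    (hg : ContMDiffAt I' (𝓡 d) ∞ g z₀)
    (hY : ContMDiffAt I' (𝓡 (m + 1)).tangent ∞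
      (fun z => (⟨C.proj (g z), Y z⟩ : TangentBundle (𝓡 (m + 1)) N)) z₀) :
    ContMDiffAt I' 𝓘(ℝ, Vec m) ∞ (fun z => C.tractorConn T (g z) (Y z)) z₀ := by
  obtain ⟨U, hU, hx, s, ψ, hs, hψ, hps, hu⟩ := C.locally_trivial (C.proj (g z₀))
  have hcont : ContinuousAt (fun z => C.proj (g z)) z₀ :=
    C.contMDiff_proj.continuous.continuousAt.comp hg.continuousAt
  have hev : ∀ᶠ z in nhds z₀, C.proj (g z) ∈ U := hcont (hU.mem_nhds hx)
  have hts := hs.contMDiffOn_tangentMapWithin (m := ∞) (by simp) hU.uniqueMDiffOn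
  have hopen : IsOpen (Bundle.TotalSpace.proj ⁻¹' U : Set (TangentBundle (𝓡 (m + 1)) N)) :=
    hU.preimage (FiberBundle.continuous_proj _ _)
  have h1 := (hts.contMDiffAt (hopen.mem_nhds
    (show (⟨C.proj (g z₀), Y z₀⟩ : TangentBundle (𝓡 (m + 1)) N) ∈ _ from hx))).comp z₀ hY
  have h2 := (C.contMDiff_tractorDeriv hT.smooth _).comp z₀ h1
  have hpo : IsOpen (C.proj ⁻¹' U) := hU.preimage C.contMDiff_proj.continuous
  have h3 := (hψ.contMDiffAt (hpo.mem_nhds hx)).comp z₀ hg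
  have h4 := (contDiff_inv_mulVec_entries.contMDiff _).comp z₀ (h3.prodMk_space h2)
  refine h4.congr_of_eventuallyEq ?_
  filter_upwards [hev] with z hz
  have hw : mfderivWithin (𝓡 (m + 1)) (𝓡 d) s U (C.proj (g z))
      = mfderiv (𝓡 (m + 1)) (𝓡 d) s (C.proj (g z)) :=
    mfderivWithin_of_isOpen hU hz
  have hdp := C.dproj_mfderiv_section hU hs hps hz (fun _ => Y z)
  have h5 := C.tractorConn_act hT (s (C.proj (g z))) (ψ (g z)) (fun _ => Y z)
  rw [C.tractorConn_eq hT hdp, hu (g z) hz, matH_inv] at h5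
  refine h5.trans ?_
  show _ = (gram m * (matH (ψ (g z)))ᵀ * gram m) *ᵥ C.tractorDeriv T (s (C.proj (g z)))
    (mfderivWithin (𝓡 (m + 1)) (𝓡 d) s U (C.proj (g z)) (Y z))
  rw [hw]

theorem contMDiffAt_clm_of_apply {V F : Type*} [NormedAddCommGroup V] [NormedSpace ℝ V]
    [FiniteDimensional ℝ V] [NormedAddCommGroup F] [NormedSpace ℝ F] {A : M' → V →L[ℝ] F}
    {z₀ : M'} (h : ∀ c, ContMDiffAt I' 𝓘(ℝ, F) ∞ (fun z => A z c) z₀) :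
    ContMDiffAt I' 𝓘(ℝ, V →L[ℝ] F) ∞ A z₀ := by
  let b := Module.finBasis ℝ V
  have hA : A = fun z => ∑ i, ContinuousLinearMap.smulRightL ℝ V F
      (LinearMap.toContinuousLinearMap (b.coord i)) (A z (b i)) := by
    funext z
    ext c
    conv_lhs => rw [← b.sum_repr c, map_sum]
    simp
  rw [hA]
  refine contMDiffAt_finsetSum fun i _ => ?_
  exact ((ContinuousLinearMap.smulRightL ℝ V F
    (LinearMap.toContinuousLinearMap (b.coord i))).contMDiff _).comp z₀ (h (b i))

/-- Conversely, a family of tangent vectors of `N` is smooth when its image under `Φ` is: in a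
trivialization of `TN` the isomorphisms `φ_u` form a smooth family of invertible matrices, whose
inverses are again smooth. -/
theorem contMDiffAt_of_Phi {g : M' → P} {Y : ∀ z, TangentSpace (𝓡 (m + 1)) (C.proj (g z))}
    {z₀ : M'} (hg : ContMDiffAt I' (𝓡 d) ∞ g z₀)
    (hY : ContMDiffAt I' 𝓘(ℝ, Vec m) ∞ (fun z => C.Phi (g z) (Y z)) z₀) :
    ContMDiffAt I' (𝓡 (m + 1)).tangent ∞
      (fun z => (⟨C.proj (g z), Y z⟩ : TangentBundle (𝓡 (m + 1)) N)) z₀ := by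
  have hx : ContMDiffAt I' (𝓡 (m + 1)) ∞ (fun z => C.proj (g z)) z₀ :=
    (C.contMDiff_proj _).comp z₀ hg
  refine Bundle.contMDiffAt_totalSpace.2 ⟨hx, ?_⟩
  set e := trivializationAt (EuclideanSpace ℝ (Fin (m + 1))) (TangentSpace (𝓡 (m + 1)))
    (C.proj (g z₀)) with he
  have hev : ∀ᶠ z in nhds z₀, C.proj (g z) ∈ e.baseSet :=
    hx.continuousAt (e.open_baseSet.mem_nhds (FiberBundle.mem_baseSet_trivializationAt' _))
  let A : M' → EuclideanSpace ℝ (Fin (m + 1)) →L[ℝ] ℝ × (Fin m → ℝ) := fun z =>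
    (LinearMap.toContinuousLinearMap (C.phi (g z))).comp (e.symmL ℝ (C.proj (g z)))
  have hAc : ∀ c, ContMDiffAt I' 𝓘(ℝ, ℝ × (Fin m → ℝ)) ∞ (fun z => A z c) z₀ := by
    intro c
    have h1 : ContMDiffAt I' (𝓡 (m + 1)).tangent ∞
        (fun z => (⟨C.proj (g z), e.symmL ℝ (C.proj (g z)) c⟩ : TangentBundle (𝓡 (m + 1)) N))
        z₀ := by
      have h2 : ContMDiffAt I' ((𝓡 (m + 1)).prod 𝓘(ℝ, EuclideanSpace ℝ (Fin (m + 1)))) ∞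
          (fun z => (C.proj (g z), c)) z₀ := hx.prodMk contMDiffAt_const
      have h3 := (e.contMDiffOn_symm (n := ∞) (IB := 𝓡 (m + 1))).contMDiffAt
        (e.open_target.mem_nhds (x := (C.proj (g z₀), c))
          (e.mem_target.2 (FiberBundle.mem_baseSet_trivializationAt' _)))
      refine (h3.comp z₀ h2).congr_of_eventuallyEq ?_
      filter_upwards [hev] with z hz
      rw [e.symmL_apply hz]
      exact (e.mk_symm hz c)
    have h4 := C.contMDiffAt_tractorConn C.isTractorSection_xi hg h1
    exact ((LinearMap.toContinuousLinearMap (toLE (m := m))).contMDiff _).comp z₀ h4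
  have hA := contMDiffAt_clm_of_apply hAc
  have hinv : ∀ z (hz : C.proj (g z) ∈ e.baseSet),
      A z = (((e.continuousLinearEquivAt ℝ (C.proj (g z)) hz).symm.trans
        (C.phiEquiv (g z)).toContinuousLinearEquiv :
          EuclideanSpace ℝ (Fin (m + 1)) ≃L[ℝ] ℝ × (Fin m → ℝ)) :
          EuclideanSpace ℝ (Fin (m + 1)) →L[ℝ] ℝ × (Fin m → ℝ)) := by
    intro z hz
    ext1 c
    show C.phi (g z) (e.symmL ℝ (C.proj (g z)) c) = C.phi (g z) (e.symm (C.proj (g z)) c)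
    rw [e.symmL_apply hz]
  have hI : (A z₀).IsInvertible := ⟨_, (hinv z₀ hev.self_of_nhds).symm⟩
  have h5 := (hI.contDiffAt_map_inverse (n := ∞)).contMDiffAt.comp z₀ hA
  have h6 := h5.clm_apply
    (((LinearMap.toContinuousLinearMap (toLE (m := m))).contMDiff _).comp z₀ hY)
  refine h6.congr_of_eventuallyEq ?_
  filter_upwards [hev] with z hz
  show _ = (A z).inverse (C.phiEquiv (g z) (Y z))
  rw [hinv z hz, ContinuousLinearMap.inverse_equiv]
  show (e ⟨C.proj (g z), Y z⟩).2 = e.continuousLinearEquivAt ℝ (C.proj (g z)) hz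
    ((C.phiEquiv (g z)).symm (C.phiEquiv (g z) (Y z)))
  rw [LinearEquiv.symm_apply_apply]
  rfl

end Smoothness

/-! ### Construction of the induced structures -/

/-- Equivariance of the tractor derivative. Here `w` lies in the model space, which is the
underlying type of both tangent spaces involved. -/
theorem tractorConn_of_act_eq {T : P → Vec m} (hT : C.IsTractorSection T) {u u' : P} {a : grpH m}
    (h : C.act u a = u') (w : EuclideanSpace ℝ (Fin (m + 1))) :
    C.tractorConn T u' w = matH a⁻¹ *ᵥ C.tractorConn T u w := by
  subst h
  exact C.tractorConn_act hT u a (fun _ => w)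

theorem Phi_of_act_eq {u u' : P} {a : grpH m}
    (h : C.act u a = u') (w : EuclideanSpace ℝ (Fin (m + 1))) :
    C.Phi u' w = matH a⁻¹ *ᵥ C.Phi u w :=
  C.tractorConn_of_act_eq C.isTractorSection_xi h w

/-- A point of the fibre of `P` over `x`. -/
def pt (x : N) : P := Classical.choose (C.proj_surjective x)

theorem proj_pt (x : N) : C.proj (C.pt x) = x := Classical.choose_spec (C.proj_surjective x)

theorem exists_act_pt (u : P) : ∃ a, C.act (C.pt (C.proj u)) a = u :=
  C.act_transitive _ _ (C.proj_pt _)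

/-- The linear map `w ↦ Φ(w)` in the frame `pt x`. -/
def PhiAt (x : N) : TangentSpace (𝓡 (m + 1)) x →ₗ[ℝ] Vec m where
  toFun w := C.Phi (C.pt x) (w : EuclideanSpace ℝ (Fin (m + 1)))
  map_add' v w := C.Phi_add (C.pt x) v w
  map_smul' c w := C.Phi_smul (C.pt x) c w

theorem exists_Phi_eq_PhiAt (u : P) : ∃ a : grpH m, ∀ w : TangentSpace (𝓡 (m + 1)) (C.proj u),
    C.Phi u w = matH a⁻¹ *ᵥ C.PhiAt (C.proj u) w := by
  obtain ⟨a, ha⟩ := C.exists_act_pt u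
  exact ⟨a, fun w => C.Phi_of_act_eq ha w⟩

/-- The metric `h^ω`, as the pullback of the Lorentzian metric by `Φ`. -/
def metric : BilinField (m + 1) N := fun x =>
  LinearMap.toContinuousLinearMap
    { toFun := fun v => LinearMap.toContinuousLinearMap
        { toFun := fun w => lor (C.PhiAt x v) (C.PhiAt x w)
          map_add' := fun w w' => by rw [map_add, lor_add_right]
          map_smul' := fun c w => by rw [map_smul, lor_smul_right]; rfl }
      map_add' := fun v v' => by
        ext w
        show lor (C.PhiAt x (v + v')) (C.PhiAt x w) = _
        rw [map_add, lor_add_left]; rfl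
      map_smul' := fun c v => by
        ext w
        show lor (C.PhiAt x (c • v)) (C.PhiAt x w) = _
        rw [map_smul, lor_smul_left]; rfl }

theorem metric_apply (u : P) (v w : TangentSpace (𝓡 (m + 1)) (C.proj u)) :
    C.metric (C.proj u) v w = lor (C.Phi u v) (C.Phi u w) := by
  obtain ⟨a, ha⟩ := C.exists_Phi_eq_PhiAt u
  rw [ha, ha, lor_matH]
  rfl

/-- The vector field `Z^ω`, as the preimage of `ξ` under `Φ`. -/
def field : VField (m + 1) N := fun x =>
  (C.PhiInv (C.pt x) (vecL m) : EuclideanSpace ℝ (Fin (m + 1)))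

theorem Phi_field (u : P) : C.Phi u (C.field (C.proj u)) = vecL m := by
  obtain ⟨a, ha⟩ := C.exists_act_pt u
  rw [C.Phi_of_act_eq ha (C.field (C.proj u))]
  have h : C.Phi (C.pt (C.proj u)) (C.field (C.proj u)) = vecL m :=
    C.Phi_PhiInv (C.pt (C.proj u)) vecL_iN
  rw [h, matH_mulVec_vecL]

theorem PhiInv_Phi (u : P) (w : TangentSpace (𝓡 (m + 1)) (C.proj u)) :
    C.PhiInv u (C.Phi u w) = w :=
  C.Phi_injective u (C.Phi_PhiInv u (C.Phi_iN u w))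

theorem PhiInv_vecL (u : P) : C.PhiInv u (vecL m) = C.field (C.proj u) := by
  rw [← C.Phi_field u, PhiInv_Phi]

theorem isInducedMetric_metric : C.IsInducedMetric C.metric := by
  intro u ζ ζ'
  rw [metric_apply, lor_of_iN_eq_zero (C.Phi_iN u _) (C.Phi_iN u _), Phi_dproj, Phi_dproj]
  simp only [mulVec_vecL]
  rfl

theorem isInducedField_field : C.IsInducedField C.field := by
  intro u ζ
  rw [← (C.Phi_injective u).eq_iff, Phi_dproj, Phi_field, ← toLE_mulVec_vecL]
  have hL : toLE (vecL m) = ((1, 0) : ℝ × (Fin m → ℝ)) :=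
    Prod.ext (vecL_iL (m := m) :) (funext fun i => (vecL_iE i :))
  rw [← hL]
  exact ⟨fun h => by rw [h], toLE_injOn (lieG_mulVec_vecL_iN (C.omega u ζ).2) vecL_iN⟩

theorem metric_symm (x : N) (v w : TangentSpace (𝓡 (m + 1)) x) :
    C.metric x v w = C.metric x w v := lor_comm _ _

theorem metric_field_right (x : N) (v : TangentSpace (𝓡 (m + 1)) x) :
    C.metric x v (C.field x) = 0 := by
  obtain ⟨u, rfl⟩ := C.proj_surjective x
  rw [metric_apply, Phi_field, lor_vecL, Phi_iN]

theorem field_ne_zero (x : N) : C.field x ≠ 0 := by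
  obtain ⟨u, rfl⟩ := C.proj_surjective x
  intro h
  have h1 := C.Phi_field u
  rw [h, ← zero_smul ℝ (0 : TangentSpace (𝓡 (m + 1)) (C.proj u)), Phi_smul, zero_smul] at h1
  have h2 := congrFun h1 (iL m)
  rw [vecL_iL] at h2
  exact zero_ne_one h2

theorem ker_metric (x : N) :
    LinearMap.ker (C.metric x).toLinearMap = Submodule.span ℝ {C.field x} := by
  obtain ⟨u, rfl⟩ := C.proj_surjective x
  apply le_antisymm
  · intro v hv
    have h0 : lor (C.Phi u v) (C.Phi u v) = 0 := by
      rw [← metric_apply]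
      exact congrArg (fun L => L v) (LinearMap.mem_ker.1 hv)
    rw [lor_of_iN_eq_zero (C.Phi_iN u v) (C.Phi_iN u v),
      Finset.sum_eq_zero_iff_of_nonneg (fun i _ => mul_self_nonneg _)] at h0
    rw [Submodule.mem_span_singleton]
    refine ⟨C.Phi u v (iL m), C.Phi_injective u ?_⟩
    rw [Phi_smul, Phi_field]
    apply vec_ext
    · simp [vecL_iL]
    · intro i
      simpa [vecL_iE, eq_comm] using h0 i (Finset.mem_univ i)
    · simp [vecL_iN, C.Phi_iN]
  · rw [Submodule.span_singleton_le_iff_mem, LinearMap.mem_ker]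
    ext w
    exact (C.metric_symm _ _ _).trans (C.metric_field_right _ w)

/-! ### The transverse lightlike section -/

/-- The lightlike section `η^τ`: with respect to the frame `Φ⁻¹(e₁), …, Φ⁻¹(e_m)` and the numbers
`tᵢ = τ(Φ⁻¹(eᵢ))`, it is `n + ∑ tᵢ eᵢ - ½ ∑ tᵢ² ℓ`. -/
def eta (τ : OneForm (m + 1) N) (u : P) : Vec m :=
  Sum.elim (fun _ => -(1 / 2) * ∑ i : Fin m, τ (C.proj u) (C.PhiInv u (Pi.single (iE i) 1)) ^ 2)
    (Sum.elim (fun i => τ (C.proj u) (C.PhiInv u (Pi.single (iE i) 1))) fun _ => 1)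

theorem eta_null (τ : OneForm (m + 1) N) (u : P) : lor (C.eta τ u) (C.eta τ u) = 0 := by
  rw [lor_self]
  simp only [eta, Sum.elim_inl, Sum.elim_inr]
  ring

theorem eta_pairing (τ : OneForm (m + 1) N) (u : P) : lor (vecL m) (C.eta τ u) = 1 := by
  rw [lor_vecL_left]; rfl

variable {τ τ' : OneForm (m + 1) N}

theorem lor_Phi_eta (hτ : ∀ x, τ x (C.field x) = 1) (u : P)
    (w : TangentSpace (𝓡 (m + 1)) (C.proj u)) :
    lor (C.Phi u w) (C.eta τ u) = τ (C.proj u) w := by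
  have hv : C.Phi u w = C.Phi u w (iL m) • vecL m
      + ∑ i : Fin m, C.Phi u w (iE i) • (Pi.single (iE i) 1 : Vec m) := by
    apply vec_ext
    · simp [vecL_iL]
    · intro i
      simp [vecL_iE, Pi.single_apply, Finset.sum_apply]
    · simp [vecL_iN, C.Phi_iN]
  conv_rhs => rw [← C.PhiInv_Phi u w, hv]
  simp only [map_add, map_smul, map_sum, PhiInv_vecL, hτ]
  rw [lor_apply, C.Phi_iN]
  simp [eta]

/-- The defining properties of `η^τ` determine it. -/
theorem eq_eta (hτ : ∀ x, τ x (C.field x) = 1) (u : P) {v : Vec m} (h0 : lor v v = 0)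
    (h1 : lor (vecL m) v = 1)
    (h : ∀ w : TangentSpace (𝓡 (m + 1)) (C.proj u), lor (C.Phi u w) v = τ (C.proj u) w) :
    v = C.eta τ u := by
  refine null_vec_unique h0 (C.eta_null τ u) h1 (C.eta_pairing τ u) fun y hy => ?_
  rw [← C.Phi_PhiInv u hy, h, C.lor_Phi_eta hτ]

theorem eta_equivariant (hτ : ∀ x, τ x (C.field x) = 1) (u : P) (a : grpH m) :
    C.eta τ (C.act u a) = matH a⁻¹ *ᵥ C.eta τ u := by
  refine (C.eq_eta hτ _ ?_ ?_ fun w => ?_).symm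
  · rw [lor_matH, eta_null]
  · rw [lor_vecL_left, matH_mulVec_iN, ← lor_vecL_left (C.eta τ u), eta_pairing]
  · rw [C.Phi_of_act_eq rfl w, lor_matH]
    refine (C.lor_Phi_eta hτ u w).trans ?_
    have h : ∀ y, y = C.proj u → (τ (C.proj u) : EuclideanSpace ℝ (Fin (m + 1)) →L[ℝ] ℝ) w
        = (τ y : EuclideanSpace ℝ (Fin (m + 1)) →L[ℝ] ℝ) w := by
      rintro y rfl; rfl
    exact h _ (C.proj_act u a)

theorem Phi_screenProj (u : P) (w : TangentSpace (𝓡 (m + 1)) (C.proj u)) :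
    C.Phi u (screenProj C.field τ (C.proj u) w) = C.Phi u w - τ (C.proj u) w • vecL m := by
  rw [screenProj, Phi_sub, Phi_smul, Phi_field]

/-! ### The screen part of a covariant derivative -/

/-- The part of the covariant derivative of the section `T` of `𝒯` that is orthogonal to `ξ` and
`η`, read as an endomorphism of `TN` by means of `Φ`. -/
def screenPart (η T : P → Vec m) : EndField (m + 1) N := fun x =>
  LinearMap.toContinuousLinearMap (E := TangentSpace (𝓡 (m + 1)) x)
    { toFun := fun w => (C.PhiInv (C.pt x) (scr (η (C.pt x))
        (C.tractorConn T (C.pt x) (w : EuclideanSpace ℝ (Fin (m + 1))))) :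
        EuclideanSpace ℝ (Fin (m + 1)))
      map_add' := fun v w => by
        have h := C.tractorConn_add_right T (C.pt x) v w
        have h' := congrArg (fun y => C.PhiInv (C.pt x) (scr (η (C.pt x)) y)) h
        simp only [scr_add, map_add] at h'
        exact h'
      map_smul' := fun c w => by
        have h := C.tractorConn_smul_right T (C.pt x) c w
        have h' := congrArg (fun y => C.PhiInv (C.pt x) (scr (η (C.pt x)) y)) h
        simp only [scr_smul, map_smul] at h'
        exact h' }

theorem Phi_screenPart {η T : P → Vec m} (hη : ∀ u a, η (C.act u a) = matH a⁻¹ *ᵥ η u)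
    (h1 : ∀ u, lor (vecL m) (η u) = 1) (hT : C.IsTractorSection T) (u : P)
    (w : TangentSpace (𝓡 (m + 1)) (C.proj u)) :
    C.Phi u (C.screenPart η T (C.proj u) w) = scr (η u) (C.tractorConn T u w) := by
  obtain ⟨a, ha⟩ := C.exists_act_pt u
  have h2 := C.Phi_of_act_eq ha (C.screenPart η T (C.proj u) w)
  have h3 : C.Phi (C.pt (C.proj u)) (C.screenPart η T (C.proj u) w)
      = scr (η (C.pt (C.proj u)))
          (C.tractorConn T (C.pt (C.proj u)) (w : EuclideanSpace ℝ (Fin (m + 1)))) :=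
    C.Phi_PhiInv (C.pt (C.proj u)) (scr_iN (h1 _) _)
  refine h2.trans ?_
  rw [h3, ← scr_matH, ← hη, ha]
  exact congrArg (scr (η u)) (C.tractorConn_of_act_eq hT ha w).symm

/-! ### Calculus of tractor sections -/

/-- The derivative along `ζ` of a function on `P` with values in a normed space, as an element of
that space. -/
def diffAt {F : Type*} [NormedAddCommGroup F] [NormedSpace ℝ F] (f : P → F) (u : P)
    (ζ : TangentSpace (𝓡 d) u) : F := mfderiv (𝓡 d) 𝓘(ℝ, F) f u ζ

omit [IsManifold (𝓡 d) ∞ P] in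
theorem diffAt_bilin {F₁ F₂ G : Type*} [NormedAddCommGroup F₁] [NormedSpace ℝ F₁]
    [NormedAddCommGroup F₂] [NormedSpace ℝ F₂] [NormedAddCommGroup G] [NormedSpace ℝ G]
    (B : F₁ →L[ℝ] F₂ →L[ℝ] G) {f : P → F₁} {g : P → F₂} {u : P}
    (hf : MDifferentiableAt (𝓡 d) 𝓘(ℝ, F₁) f u) (hg : MDifferentiableAt (𝓡 d) 𝓘(ℝ, F₂) g u)
    (ζ : TangentSpace (𝓡 d) u) :
    diffAt (fun v => B (f v) (g v)) u ζ = B (f u) (diffAt g u ζ) + B (diffAt f u ζ) (g u) := by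
  have h1 := (B.isBoundedBilinearMap.hasFDerivAt (f u, g u)).hasMFDerivAt
  have hfg : HasMFDerivAt (𝓡 d) 𝓘(ℝ, F₁ × F₂) (fun v => (f v, g v)) u
      (ContinuousLinearMap.prod (M₁ := TangentSpace (𝓡 d) u) (M₂ := F₁) (M₃ := F₂)
        (mfderiv (𝓡 d) 𝓘(ℝ, F₁) f u) (mfderiv (𝓡 d) 𝓘(ℝ, F₂) g u)) :=
    ⟨hf.hasMFDerivAt.1.prodMk hg.hasMFDerivAt.1, hf.hasMFDerivAt.2.prodMk hg.hasMFDerivAt.2⟩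
  have h2 := HasMFDerivAt.comp u h1 hfg
  exact congrArg (fun L => L ζ) h2.mfderiv

theorem tractorConn_def (T : P → Vec m) (u : P) (w : TangentSpace (𝓡 (m + 1)) (C.proj u)) :
    C.tractorConn T u w
      = diffAt T u (C.lift u w) + (C.omega u (C.lift u w) : Mat m) *ᵥ T u := rfl

/-- The Lorentzian metric as a continuous bilinear map. -/
def lorCLM : Vec m →L[ℝ] Vec m →L[ℝ] ℝ :=
  LinearMap.toContinuousLinearMap
    { toFun := fun v => LinearMap.toContinuousLinearMap
        { toFun := fun w => lor v w
          map_add' := fun w w' => lor_add_right v w w'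
          map_smul' := fun c w => lor_smul_right c v w }
      map_add' := fun v v' => by ext1 w; exact lor_add_left v v' w
      map_smul' := fun c v => by ext1 w; exact lor_smul_left c v w }

theorem lorCLM_apply (v w : Vec m) : lorCLM v w = lor v w := rfl

section

variable {E' H' M' : Type*} [NormedAddCommGroup E'] [NormedSpace ℝ E'] [TopologicalSpace H']
  {I' : ModelWithCorners ℝ E' H'} [TopologicalSpace M'] [ChartedSpace H' M']

theorem contMDiffAt_lor {S T : M' → Vec m} {z : M'} (hS : ContMDiffAt I' 𝓘(ℝ, Vec m) ∞ S z)
    (hT : ContMDiffAt I' 𝓘(ℝ, Vec m) ∞ T z) :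
    ContMDiffAt I' 𝓘(ℝ, ℝ) ∞ (fun z => lor (S z) (T z)) z :=
  (((lorCLM (m := m)).contMDiff _).comp z hS).clm_apply hT

theorem contMDiffAt_scr {S T : M' → Vec m} {z : M'} (hS : ContMDiffAt I' 𝓘(ℝ, Vec m) ∞ S z)
    (hT : ContMDiffAt I' 𝓘(ℝ, Vec m) ∞ T z) :
    ContMDiffAt I' 𝓘(ℝ, Vec m) ∞ (fun z => scr (S z) (T z)) z :=
  (hT.sub ((contMDiffAt_lor hT hS).smul contMDiffAt_const)).sub
    ((contMDiffAt_lor hT contMDiffAt_const).smul hS)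

end

theorem tractorConn_add_left {S T : P → Vec m} (hS : ContMDiff (𝓡 d) 𝓘(ℝ, Vec m) ∞ S)
    (hT : ContMDiff (𝓡 d) 𝓘(ℝ, Vec m) ∞ T) (u : P)
    (w : TangentSpace (𝓡 (m + 1)) (C.proj u)) :
    C.tractorConn (fun v => S v + T v) u w = C.tractorConn S u w + C.tractorConn T u w := by
  have h : diffAt (fun v => S v + T v) u (C.lift u w)
      = diffAt S u (C.lift u w) + diffAt T u (C.lift u w) :=
    congrArg (fun L => L (C.lift u w)) (mfderiv_add ((hS u).mdifferentiableAt (by simp))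
      ((hT u).mdifferentiableAt (by simp)))
  rw [tractorConn_def, tractorConn_def, tractorConn_def, h, Matrix.mulVec_add]
  exact add_add_add_comm _ _ _ _

theorem diffAt_comp_proj {f : N → ℝ} (hf : IsSmoothFun (n := m + 1) f) (W : VField (m + 1) N)
    (u : P) :
    diffAt (fun v => f (C.proj v)) u (C.lift u (W (C.proj u))) = dirDeriv W f (C.proj u) := by
  have h := mfderiv_comp u ((hf (C.proj u)).mdifferentiableAt (by simp))
    ((C.contMDiff_proj u).mdifferentiableAt (by simp))
  have h' : diffAt (fun v => f (C.proj v)) u (C.lift u (W (C.proj u)))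
      = mfderiv (𝓡 (m + 1)) 𝓘(ℝ, ℝ) f (C.proj u)
          (C.dproj u (C.lift u (W (C.proj u)))) :=
    congrArg (fun L => L (C.lift u (W (C.proj u)))) h
  rw [h', dproj_lift]
  rfl

theorem tractorConn_smul_left {f : N → ℝ} (hf : IsSmoothFun (n := m + 1) f) {T : P → Vec m}
    (hT : ContMDiff (𝓡 d) 𝓘(ℝ, Vec m) ∞ T) (W : VField (m + 1) N) (u : P) :
    C.tractorConn (fun v => f (C.proj v) • T v) u (W (C.proj u))
      = dirDeriv W f (C.proj u) • T u + f (C.proj u) • C.tractorConn T u (W (C.proj u)) := by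
  have h := diffAt_bilin (ContinuousLinearMap.lsmul ℝ ℝ)
    (((hf.comp C.contMDiff_proj) u).mdifferentiableAt (by simp))
    ((hT u).mdifferentiableAt (by simp)) (C.lift u (W (C.proj u)))
  have h' : diffAt (fun v => f (C.proj v) • T v) u (C.lift u (W (C.proj u)))
      = f (C.proj u) • diffAt T u (C.lift u (W (C.proj u))) + dirDeriv W f (C.proj u) • T u := by
    rw [← C.diffAt_comp_proj hf]
    exact h
  rw [tractorConn_def, tractorConn_def, h', Matrix.mulVec_smul, smul_add]
  abel

/-- The tractor connection is metric. -/
theorem dirDeriv_lor {f : N → ℝ} (hf : IsSmoothFun (n := m + 1) f) {S T : P → Vec m}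
    (hS : ContMDiff (𝓡 d) 𝓘(ℝ, Vec m) ∞ S) (hT : ContMDiff (𝓡 d) 𝓘(ℝ, Vec m) ∞ T)
    (h : ∀ u, f (C.proj u) = lor (S u) (T u)) (W : VField (m + 1) N) (u : P) :
    dirDeriv W f (C.proj u) = lor (C.tractorConn S u (W (C.proj u))) (T u)
      + lor (S u) (C.tractorConn T u (W (C.proj u))) := by
  have h1 := diffAt_bilin (lorCLM (m := m)) ((hS u).mdifferentiableAt (by simp))
    ((hT u).mdifferentiableAt (by simp)) (C.lift u (W (C.proj u)))
  have h2 : (fun v => lorCLM (S v) (T v)) = fun v => f (C.proj v) := by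
    funext v; exact (h v).symm
  rw [h2, C.diffAt_comp_proj hf, lorCLM_apply, lorCLM_apply] at h1
  have h3 := lor_lieG (C.omega u (C.lift u (W (C.proj u)))).2 (S u) (T u)
  rw [tractorConn_def, tractorConn_def, lor_add_left, lor_add_right, h1]
  linarith

theorem lor_tractorConn_of_const {c : ℝ} {S T : P → Vec m}
    (hS : ContMDiff (𝓡 d) 𝓘(ℝ, Vec m) ∞ S) (hT : ContMDiff (𝓡 d) 𝓘(ℝ, Vec m) ∞ T)
    (h : ∀ u, lor (S u) (T u) = c) (u : P) (w : TangentSpace (𝓡 (m + 1)) (C.proj u)) :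
    lor (C.tractorConn S u w) (T u) + lor (S u) (C.tractorConn T u w) = 0 := by
  have h1 := C.dirDeriv_lor (f := fun _ => c) contMDiff_const hS hT (fun u => (h u).symm)
    (fun _ => w) u
  have h2 : dirDeriv (n := m + 1) (fun _ : N => w) (fun _ => c) (C.proj u) = 0 := by
    unfold dirDeriv
    rw [mfderiv_const]; rfl
  exact h1.symm.trans h2

/-- The function `P → 𝕃^{m+2}` of the section `Φ(X)` of `𝒯`. -/
def PhiSec (X : VField (m + 1) N) : P → Vec m := fun u => C.Phi u (X (C.proj u))

/-- The projection of `P` has local sections, so smoothness can be tested after composition with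
it. -/
theorem contMDiff_of_comp_proj {E' H' M' : Type*} [NormedAddCommGroup E'] [NormedSpace ℝ E']
    [TopologicalSpace H'] {I' : ModelWithCorners ℝ E' H'} [TopologicalSpace M']
    [ChartedSpace H' M'] {F : N → M'}
    (h : ContMDiff (𝓡 d) I' ∞ (fun u => F (C.proj u))) : ContMDiff (𝓡 (m + 1)) I' ∞ F := by
  intro x
  obtain ⟨U, hU, hx, s, -, hs, -, hps, -⟩ := C.locally_trivial x
  refine ((h (s x)).comp x (hs.contMDiffAt (hU.mem_nhds hx))).congr_of_eventuallyEq ?_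
  filter_upwards [hU.mem_nhds hx] with y hy
  exact congrArg F (hps y hy).symm

theorem isTractorSection_PhiSec_of_contMDiff {X : VField (m + 1) N}
    (h : ContMDiff (𝓡 d) 𝓘(ℝ, Vec m) ∞ (C.PhiSec X)) : C.IsTractorSection (C.PhiSec X) :=
  ⟨h, fun u a => C.Phi_act u a X⟩

section Structures

variable [IsManifold (𝓡 (m + 1)) ∞ N]

theorem isSmoothField_of_PhiSec {X : VField (m + 1) N}
    (h : ContMDiff (𝓡 d) 𝓘(ℝ, Vec m) ∞ (C.PhiSec X)) : IsSmoothField X :=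
  C.contMDiff_of_comp_proj fun u => C.contMDiffAt_of_Phi contMDiffAt_id (h u)

theorem contMDiff_tractorConn {T : P → Vec m} (hT : C.IsTractorSection T) {W : VField (m + 1) N}
    (hW : IsSmoothField W) :
    ContMDiff (𝓡 d) 𝓘(ℝ, Vec m) ∞ (fun u => C.tractorConn T u (W (C.proj u))) :=
  fun u => C.contMDiffAt_tractorConn hT contMDiffAt_id ((hW.comp C.contMDiff_proj) u)

theorem isTractorSection_PhiSec {X : VField (m + 1) N} (hX : IsSmoothField X) :
    C.IsTractorSection (C.PhiSec X) :=
  C.isTractorSection_PhiSec_of_contMDiff (C.contMDiff_tractorConn C.isTractorSection_xi hX)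

theorem isSmoothFun_form {τ : OneForm (m + 1) N} (hτ : IsSmoothForm τ) {X : VField (m + 1) N}
    (hX : IsSmoothField X) : IsSmoothFun (n := m + 1) (fun x => τ x (X x)) :=
  ContMDiff.comp hτ hX

theorem isSmoothFun_metric {V W : VField (m + 1) N} (hV : IsSmoothField V)
    (hW : IsSmoothField W) : IsSmoothFun (n := m + 1) (fun x => C.metric x (V x) (W x)) := by
  refine C.contMDiff_of_comp_proj fun u => ?_
  simp only [metric_apply]
  exact contMDiffAt_lor ((C.isTractorSection_PhiSec hV).smooth u)
    ((C.isTractorSection_PhiSec hW).smooth u)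

theorem isSmoothField_field : IsSmoothField C.field := by
  apply C.isSmoothField_of_PhiSec
  have h : C.PhiSec C.field = fun _ => vecL m := funext C.Phi_field
  rw [h]
  exact contMDiff_const

theorem isLightlikeMetric_metric : IsLightlikeMetric C.metric where
  smooth _ _ hV hW := C.isSmoothFun_metric hV hW
  symm := C.metric_symm
  nonneg x v := by
    obtain ⟨u, rfl⟩ := C.proj_surjective x
    rw [metric_apply, lor_of_iN_eq_zero (C.Phi_iN u v) (C.Phi_iN u v)]
    exact Finset.sum_nonneg fun i _ => mul_self_nonneg _
  radical x := by rw [ker_metric, finrank_span_singleton (C.field_ne_zero x)]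

theorem spansRadical_field : SpansRadical C.metric C.field :=
  ⟨C.isSmoothField_field, C.ker_metric⟩

theorem isTractorSection_eta (hτ : τ ∈ screenForms C.field) : C.IsTractorSection (C.eta τ) where
  smooth := by
    have ht : ∀ i : Fin m, ContMDiff (𝓡 d) 𝓘(ℝ, ℝ) ∞
        (fun u => τ (C.proj u) (C.PhiInv u (Pi.single (iE i) 1))) := by
      intro i u
      have h1 : ∀ v, C.Phi v (C.PhiInv v (Pi.single (iE i) 1)) = Pi.single (iE i) 1 :=
        fun v => C.Phi_PhiInv v (by simp)
      have h2 := C.contMDiffAt_of_Phi (g := id) (z₀ := u)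
        (Y := fun v => C.PhiInv v (Pi.single (iE i) 1)) contMDiffAt_id (by
          simp only [id, h1]; exact contMDiffAt_const)
      exact (hτ.1 _).comp u h2
    refine contMDiff_pi_space.2 ?_
    rintro (_ | i | _)
    · refine ContMDiff.mul contMDiff_const (contMDiff_finsetSum fun i _ => ?_)
      exact (ht i).pow 2
    · exact ht i
    · exact contMDiff_const
  equivariant := C.eta_equivariant hτ.2

theorem isTransverse_eta (hτ : τ ∈ screenForms C.field) : C.IsTransverse τ (C.eta τ) where
  isSection := C.isTractorSection_eta hτ
  null := C.eta_null τ
  pairing := C.eta_pairing τ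
  orthogonal u w hw := by rw [C.lor_Phi_eta hτ.2, hw]

/-! ### The screen connection and the screen morphism -/

/-- The connection `∇^τ`: the screen part of the derivatives of the sections `Φ(X)`. -/
def conn (τ : OneForm (m + 1) N) (X : VField (m + 1) N) : EndField (m + 1) N :=
  C.screenPart (C.eta τ) (C.PhiSec X)

/-- The morphism `D^τ`: the screen part of the derivative of `η^τ`. -/
def shape (τ : OneForm (m + 1) N) : EndField (m + 1) N := C.screenPart (C.eta τ) (C.eta τ)

theorem Phi_conn (hτ : τ ∈ screenForms C.field) {X : VField (m + 1) N}
    (hX : C.IsTractorSection (C.PhiSec X)) (u : P) (w : TangentSpace (𝓡 (m + 1)) (C.proj u)) :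
    C.Phi u (C.conn τ X (C.proj u) w) = scr (C.eta τ u) (C.tractorConn (C.PhiSec X) u w) :=
  C.Phi_screenPart (C.eta_equivariant hτ.2) (C.eta_pairing τ) hX u w

theorem Phi_shape (hτ : τ ∈ screenForms C.field) (u : P)
    (w : TangentSpace (𝓡 (m + 1)) (C.proj u)) :
    C.Phi u (C.shape τ (C.proj u) w) = scr (C.eta τ u) (C.tractorConn (C.eta τ) u w) :=
  C.Phi_screenPart (C.eta_equivariant hτ.2) (C.eta_pairing τ) (C.isTractorSection_eta hτ) u w

theorem form_screenPart (hτ : τ ∈ screenForms C.field) {T : P → Vec m}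
    (hT : C.IsTractorSection T) (x : N) (w : TangentSpace (𝓡 (m + 1)) x) :
    τ x (C.screenPart (C.eta τ) T x w) = 0 := by
  obtain ⟨u, rfl⟩ := C.proj_surjective x
  rw [← C.lor_Phi_eta hτ.2, C.Phi_screenPart (C.eta_equivariant hτ.2) (C.eta_pairing τ) hT,
    lor_scr (C.eta_null τ u) (C.eta_pairing τ u)]

theorem scr_eta_Phi (hτ : τ ∈ screenForms C.field) (u : P)
    (w : TangentSpace (𝓡 (m + 1)) (C.proj u)) :
    scr (C.eta τ u) (C.Phi u w) = C.Phi u w - τ (C.proj u) w • vecL m := by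
  rw [scr_of_iN_eq_zero _ (C.Phi_iN u w), C.lor_Phi_eta hτ.2]

/-- The derivative of `η^τ` in the splitting determined by `τ`. -/
theorem tractorConn_eta (hτ : τ ∈ screenForms C.field) (u : P)
    (w : TangentSpace (𝓡 (m + 1)) (C.proj u)) :
    C.tractorConn (C.eta τ) u w
      = C.Phi u (C.shape τ (C.proj u) w) - τ (C.proj u) w • C.eta τ u := by
  have hη := (C.isTractorSection_eta hτ).smooth
  have h1 := C.lor_tractorConn_of_const hη hη (C.eta_null τ) u w
  have h2 := C.lor_tractorConn_of_const contMDiff_const hη (C.eta_pairing τ) u w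
  have h3 : lor (C.tractorConn (fun _ => vecL m) u w) (C.eta τ u) = τ (C.proj u) w :=
    C.lor_Phi_eta hτ.2 u w
  rw [lor_comm (C.eta τ u)] at h1
  rw [h3, lor_comm (vecL m)] at h2
  have h4 := eq_scr_add (C.eta τ u) (C.tractorConn (C.eta τ) u w)
  rw [← C.Phi_shape hτ, show lor (C.tractorConn (C.eta τ) u w) (C.eta τ u) = 0 by linarith,
    show lor (C.tractorConn (C.eta τ) u w) (vecL m) = -τ (C.proj u) w by linarith] at h4
  rw [h4]
  module

/-- The derivative of `Φ(X)` in the splitting determined by `τ`. -/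
theorem tractorConn_PhiSec (hτ : τ ∈ screenForms C.field) {X : VField (m + 1) N}
    (hX : X ∈ screenSections τ) (u : P) (w : TangentSpace (𝓡 (m + 1)) (C.proj u)) :
    C.tractorConn (C.PhiSec X) u w
      = -(C.metric (C.proj u) (X (C.proj u)) (C.shape τ (C.proj u) w)) • vecL m
        + C.Phi u (C.conn τ X (C.proj u) w)
        - C.metric (C.proj u) (X (C.proj u)) w • C.eta τ u := by
  have hη := (C.isTractorSection_eta hτ).smooth
  have hΦ := C.isTractorSection_PhiSec hX.1
  have h1 := C.lor_tractorConn_of_const hΦ.smooth hη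
    (fun v => (C.lor_Phi_eta hτ.2 v (X (C.proj v))).trans (hX.2 _)) u w
  have h2 := C.lor_tractorConn_of_const hΦ.smooth contMDiff_const
    (fun v => (lor_vecL (C.PhiSec X v)).trans (C.Phi_iN v _)) u w
  have h3 : lor (C.PhiSec X u) (C.tractorConn (fun _ => vecL m) u w)
      = C.metric (C.proj u) (X (C.proj u)) w := (C.metric_apply u _ _).symm
  have h5 : lor (C.PhiSec X u) (C.tractorConn (C.eta τ) u w)
      = C.metric (C.proj u) (X (C.proj u)) (C.shape τ (C.proj u) w) := by
    rw [C.tractorConn_eta hτ, lor_sub_right, lor_smul_right, PhiSec, C.lor_Phi_eta hτ.2, hX.2,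
      metric_apply]
    ring
  have h4 := eq_scr_add (C.eta τ u) (C.tractorConn (C.PhiSec X) u w)
  rw [← C.Phi_conn hτ hΦ,
    show lor (C.tractorConn (C.PhiSec X) u w) (C.eta τ u)
      = -C.metric (C.proj u) (X (C.proj u)) (C.shape τ (C.proj u) w) by linarith,
    show lor (C.tractorConn (C.PhiSec X) u w) (vecL m)
      = -C.metric (C.proj u) (X (C.proj u)) w by linarith] at h4
  rw [h4]
  module

theorem isTractorForm (hτ : τ ∈ screenForms C.field) :
    C.IsTractorForm C.metric C.field τ (C.eta τ) (C.conn τ) (C.shape τ) := by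
  intro α β X W hα hβ hX hW u
  have hη := (C.isTractorSection_eta hτ).smooth
  have hΦ := (C.isTractorSection_PhiSec hX.1).smooth
  have hξ : ContMDiff (𝓡 d) 𝓘(ℝ, Vec m) ∞ (fun _ : P => vecL m) := contMDiff_const
  have h1 : ContMDiff (𝓡 d) 𝓘(ℝ, Vec m) ∞ (fun v : P => α (C.proj v) • vecL m) :=
    ContMDiff.smul (hα.comp C.contMDiff_proj) hξ
  have h2 : ContMDiff (𝓡 d) 𝓘(ℝ, Vec m) ∞ (fun v : P => β (C.proj v) • C.eta τ v) :=
    ContMDiff.smul (hβ.comp C.contMDiff_proj) hη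
  have h3 : C.tractorConn (fun _ => vecL m) u (W (C.proj u))
      = C.Phi u (screenProj C.field τ (C.proj u) (W (C.proj u)))
        + τ (C.proj u) (W (C.proj u)) • vecL m := by
    rw [Phi_screenProj, sub_add_cancel]; rfl
  have h4 : C.tractorConn (C.column (C.eta τ) α X β) u (W (C.proj u)) = _ :=
    C.tractorConn_add_left (S := fun v => α (C.proj v) • vecL m + C.PhiSec X v)
      (h1.add hΦ) h2 u (W (C.proj u))
  rw [h4, C.tractorConn_add_left h1 hΦ, C.tractorConn_smul_left hα hξ,
    C.tractorConn_smul_left hβ hη, h3, C.tractorConn_PhiSec hτ hX, C.tractorConn_eta hτ, column,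
    Phi_add, Phi_add, Phi_smul, Phi_smul]
  module

theorem isMetricConnection_conn (hτ : τ ∈ screenForms C.field) :
    IsMetricConnection C.metric τ (C.conn τ) where
  mem X hX W hW := by
    have hΦ := C.isTractorSection_PhiSec hX.1
    refine ⟨C.isSmoothField_of_PhiSec ?_, fun x => C.form_screenPart hτ hΦ x _⟩
    intro u
    have h := contMDiffAt_scr ((C.isTractorSection_eta hτ).smooth u)
      (C.contMDiff_tractorConn hΦ hW u)
    exact h.congr_of_eventuallyEq (Filter.Eventually.of_forall fun v => C.Phi_conn hτ hΦ v _)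
  add X hX Y hY x w := by
    obtain ⟨u, rfl⟩ := C.proj_surjective x
    have hΦ := C.isTractorSection_PhiSec hX.1
    have hΨ := C.isTractorSection_PhiSec hY.1
    have e : C.PhiSec (fun y => X y + Y y) = fun v => C.PhiSec X v + C.PhiSec Y v :=
      funext fun v => C.Phi_add v _ _
    have hS : C.IsTractorSection (C.PhiSec (fun y => X y + Y y)) :=
      C.isTractorSection_PhiSec_of_contMDiff (by rw [e]; exact hΦ.smooth.add hΨ.smooth)
    apply C.Phi_injective u
    rw [C.Phi_conn hτ hS, Phi_add, C.Phi_conn hτ hΦ, C.Phi_conn hτ hΨ, e,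
      C.tractorConn_add_left hΦ.smooth hΨ.smooth, scr_add]
  leibniz f hf X hX W x := by
    obtain ⟨u, rfl⟩ := C.proj_surjective x
    have hΦ := C.isTractorSection_PhiSec hX.1
    have e : C.PhiSec (fun y => f y • X y) = fun v => f (C.proj v) • C.PhiSec X v :=
      funext fun v => C.Phi_smul v _ _
    have hS : C.IsTractorSection (C.PhiSec (fun y => f y • X y)) :=
      C.isTractorSection_PhiSec_of_contMDiff
        (by rw [e]; exact ContMDiff.smul (hf.comp C.contMDiff_proj) hΦ.smooth)
    have h0 : scr (C.eta τ u) (C.PhiSec X u) = C.Phi u (X (C.proj u)) := by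
      rw [PhiSec, C.scr_eta_Phi hτ, hX.2, zero_smul, sub_zero]
    apply C.Phi_injective u
    rw [C.Phi_conn hτ hS, Phi_add, Phi_smul, Phi_smul, C.Phi_conn hτ hΦ, e,
      C.tractorConn_smul_left hf hΦ.smooth, scr_add, scr_smul, scr_smul, h0]
  metric X hX Y hY W hW x := by
    obtain ⟨u, rfl⟩ := C.proj_surjective x
    have hΦ := C.isTractorSection_PhiSec hX.1
    have hΨ := C.isTractorSection_PhiSec hY.1
    rw [C.dirDeriv_lor (C.isSmoothFun_metric hX.1 hY.1) hΦ.smooth hΨ.smooth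
      (fun v => C.metric_apply v _ _), C.tractorConn_PhiSec hτ hX, C.tractorConn_PhiSec hτ hY]
    have h1 : ∀ Z ∈ screenSections τ, lor (C.PhiSec Z u) (C.eta τ u) = 0 := fun Z hZ =>
      (C.lor_Phi_eta hτ.2 u (Z (C.proj u))).trans (hZ.2 _)
    have h2 : ∀ Z, lor (C.PhiSec Z u) (vecL m) = 0 := fun Z =>
      (lor_vecL _).trans (C.Phi_iN u _)
    simp only [lor_add_left, lor_sub_left, lor_smul_left, lor_add_right, lor_sub_right,
      lor_smul_right, lor_comm (vecL m), lor_comm (C.eta τ u), h1 X hX, h1 Y hY, h2]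
    rw [C.metric_apply u (C.conn τ X _ _), C.metric_apply u (X _) (C.conn τ Y _ _)]
    simp only [PhiSec]
    ring

theorem isScreenMorphism_shape (hτ : τ ∈ screenForms C.field) :
    IsScreenMorphism τ (C.shape τ) where
  smooth := by
    intro v₀
    have hη := C.isTractorSection_eta hτ
    obtain ⟨U, hU, hx, s, -, hs, -, hps, -⟩ := C.locally_trivial v₀.1
    have hπ : ContMDiffAt (𝓡 (m + 1)).tangent (𝓡 (m + 1)) ∞
        (fun v : TangentBundle (𝓡 (m + 1)) N => v.1) v₀ :=
      Bundle.contMDiff_proj (TangentSpace (𝓡 (m + 1)) (M := N)) v₀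
    have hg : ContMDiffAt (𝓡 (m + 1)).tangent (𝓡 d) ∞
        (fun v : TangentBundle (𝓡 (m + 1)) N => s v.1) v₀ :=
      (hs.contMDiffAt (hU.mem_nhds hx)).comp v₀ hπ
    have hev : ∀ᶠ v : TangentBundle (𝓡 (m + 1)) N in nhds v₀, C.proj (s v.1) = v.1 := by
      filter_upwards [hπ.continuousAt (hU.mem_nhds hx)] with v hv
      exact hps _ hv
    -- Transport of tangent vectors along the equality `proj (s x) = x`.
    have hmk : ∀ (A : EndField (m + 1) N) (x y : N) (w : EuclideanSpace ℝ (Fin (m + 1))), x = y →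
        (⟨x, (A x : EuclideanSpace ℝ (Fin (m + 1)) →L[ℝ] EuclideanSpace ℝ (Fin (m + 1))) w⟩ :
          TangentBundle (𝓡 (m + 1)) N)
        = ⟨y, (A y : EuclideanSpace ℝ (Fin (m + 1)) →L[ℝ] EuclideanSpace ℝ (Fin (m + 1))) w⟩ := by
      rintro A x y w rfl; rfl
    have hid : ContMDiffAt (𝓡 (m + 1)).tangent (𝓡 (m + 1)).tangent ∞
        (fun v : TangentBundle (𝓡 (m + 1)) N =>
          (⟨C.proj (s v.1), (v.2 : EuclideanSpace ℝ (Fin (m + 1)))⟩ :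
            TangentBundle (𝓡 (m + 1)) N)) v₀ := by
      refine contMDiffAt_id.congr_of_eventuallyEq ?_
      filter_upwards [hev] with v hv
      exact hmk (fun _ => ContinuousLinearMap.id ℝ (EuclideanSpace ℝ (Fin (m + 1)))) _ _ v.2 hv
    have h1 := contMDiffAt_scr ((hη.smooth _).comp v₀ hg) (C.contMDiffAt_tractorConn hη hg hid)
    have h2 := C.contMDiffAt_of_Phi
      (Y := fun v : TangentBundle (𝓡 (m + 1)) N =>
        C.shape τ (C.proj (s v.1)) (v.2 : EuclideanSpace ℝ (Fin (m + 1)))) hg (by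
        refine h1.congr_of_eventuallyEq (Filter.Eventually.of_forall fun v => ?_)
        exact C.Phi_shape hτ (s v.1) (v.2 : EuclideanSpace ℝ (Fin (m + 1))))
    refine h2.congr_of_eventuallyEq ?_
    filter_upwards [hev] with v hv
    exact (hmk (C.shape τ) _ _ v.2 hv).symm
  mem x v := C.form_screenPart hτ (C.isTractorSection_eta hτ) x v

end Structures

/-! ### Dependence on the screen distribution -/

theorem metric_eq_sum (u : P) (v w : TangentSpace (𝓡 (m + 1)) (C.proj u)) :
    C.metric (C.proj u) v w = ∑ i : Fin m, C.Phi u v (iE i) * C.Phi u w (iE i) := by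
  rw [metric_apply, lor_of_iN_eq_zero (C.Phi_iN u v) (C.Phi_iN u w)]

/-- The fibres of `An(τ)` have orthonormal frames: the projections of the vectors `Φ⁻¹(eᵢ)`. -/
theorem screenFrame_spec (hτ : ∀ x, τ x (C.field x) = 1) (x : N) :
    (∀ i, τ x (screenFrame C.metric τ x i) = 0) ∧
      ∀ i j, C.metric x (screenFrame C.metric τ x i) (screenFrame C.metric τ x j)
        = if i = j then 1 else 0 := by
  refine Classical.epsilon_spec (p := fun e : Fin m → TangentSpace (𝓡 (m + 1)) x =>
    (∀ i, τ x (e i) = 0) ∧ ∀ i j, C.metric x (e i) (e j) = if i = j then 1 else 0) ?_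
  obtain ⟨u, rfl⟩ := C.proj_surjective x
  refine ⟨fun i => screenProj C.field τ _ (C.PhiInv u (Pi.single (iE i) 1)), fun i => ?_,
    fun i j => ?_⟩
  · simp [screenProj, hτ]
  · have h : ∀ i k : Fin m, C.Phi u (screenProj C.field τ (C.proj u)
        (C.PhiInv u (Pi.single (iE i) 1))) (iE k) = if k = i then 1 else 0 := by
      intro i k
      rw [Phi_screenProj, C.Phi_PhiInv u (by simp)]
      simp [vecL_iE, Pi.single_apply]
    rw [metric_eq_sum]
    simp only [h]
    simp [eq_comm]

/-- Expansion of a tangent vector in `Z` and an orthonormal frame of `An(τ)`. -/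
theorem eq_sum_screenFrame (hτ : ∀ x, τ x (C.field x) = 1) (x : N)
    (v : TangentSpace (𝓡 (m + 1)) x) :
    v = ∑ i, C.metric x (screenFrame C.metric τ x i) v • screenFrame C.metric τ x i
      + τ x v • C.field x := by
  obtain ⟨h0, h1⟩ := C.screenFrame_spec hτ x
  set e := screenFrame C.metric τ x
  obtain ⟨u, rfl⟩ := C.proj_surjective x
  -- The components of an orthonormal frame form an orthogonal matrix, whose columns are
  -- therefore orthonormal as well.
  let M : Matrix (Fin m) (Fin m) ℝ := Matrix.of fun i j => C.Phi u (e i) (iE j)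
  have hM : M * Mᵀ = 1 := by
    ext i j
    rw [Matrix.mul_apply, Matrix.one_apply, ← h1 i j, metric_eq_sum]
    rfl
  have hM' : Mᵀ * M = 1 := mul_eq_one_comm.1 hM
  set v' := ∑ i, C.metric (C.proj u) (e i) v • e i + τ (C.proj u) v • C.field (C.proj u) with hv'
  have hτv : τ (C.proj u) v' = τ (C.proj u) v := by simp [hv', h0, hτ]
  have hE : ∀ j, C.Phi u v' (iE j) = C.Phi u v (iE j) := by
    intro j
    have hcol : ∀ k, ∑ i, C.Phi u (e i) (iE k) * C.Phi u (e i) (iE j) = if k = j then 1 else 0 :=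
      fun k => congrFun (congrFun hM' k) j
    calc C.Phi u v' (iE j) = ∑ i, C.metric (C.proj u) (e i) v * C.Phi u (e i) (iE j) := by
          have h := congrArg (fun y : ℝ × (Fin m → ℝ) => y.2 j) (map_add (C.phi u)
            (∑ i, C.metric (C.proj u) (e i) v • e i) (τ (C.proj u) v • C.field (C.proj u)))
          rw [map_sum] at h
          simp only [map_smul] at h
          refine h.trans ?_
          have hZ : (C.phi u (C.field (C.proj u))).2 j = 0 :=
            (congrFun (C.Phi_field u) (iE j)).trans (vecL_iE j)
          simp only [Prod.snd_add, Prod.snd_sum, Prod.smul_snd, Pi.add_apply, Finset.sum_apply,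
            Pi.smul_apply, hZ, smul_eq_mul, mul_zero, add_zero]
          rfl
      _ = ∑ k, C.Phi u v (iE k) * ∑ i, C.Phi u (e i) (iE k) * C.Phi u (e i) (iE j) := by
          simp only [metric_eq_sum, Finset.sum_mul, Finset.mul_sum]
          rw [Finset.sum_comm]
          exact Finset.sum_congr rfl fun k _ => Finset.sum_congr rfl fun i _ => by ring
      _ = C.Phi u v (iE j) := by simp [hcol]
  -- `v - v'` is a multiple of `Z` that `τ` annihilates.
  have hd : C.Phi u v - C.Phi u v' = (C.Phi u v - C.Phi u v') (iL m) • vecL m := by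
    apply vec_ext
    · simp [vecL_iL]
    · intro i; simp [vecL_iE, hE]
    · simp [vecL_iN, C.Phi_iN]
  have hlor : lor (C.Phi u v - C.Phi u v') (C.eta τ u) = 0 := by
    rw [lor_sub_left, C.lor_Phi_eta hτ, C.lor_Phi_eta hτ, hτv, sub_self]
  rw [hd, lor_smul_left, eta_pairing, mul_one] at hlor
  rw [hlor, zero_smul, sub_eq_zero] at hd
  exact C.Phi_injective u hd

theorem metric_diffField (hτ' : ∀ x, τ' x (C.field x) = 1) (hτ : ∀ x, τ x (C.field x) = 1) (x : N)
    (v : TangentSpace (𝓡 (m + 1)) x) :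
    C.metric x (diffField C.metric τ τ' x) v = τ x v - τ' x v := by
  conv_rhs => rw [C.eq_sum_screenFrame hτ' x v]
  rw [diffField]
  simp only [map_sum, map_smul, map_add, hτ, hτ', (C.screenFrame_spec hτ' x).1,
    sum_apply, smul_apply, smul_eq_mul]
  simp [mul_comm]

theorem form_diffField (hτ' : ∀ x, τ' x (C.field x) = 1) (x : N) :
    τ' x (diffField C.metric τ τ' x) = 0 := by
  simp [diffField, (C.screenFrame_spec hτ' x).1]

/-- The change of the transverse section with the screen distribution: the right-hand side has the
properties that characterize `η^τ`. -/
theorem eta_eq (hτ : ∀ x, τ x (C.field x) = 1) (hτ' : ∀ x, τ' x (C.field x) = 1) (u : P) :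
    C.eta τ u = C.eta τ' u + C.Phi u (diffField C.metric τ τ' (C.proj u))
      - ((1 / 2 : ℝ) * C.metric (C.proj u) (diffField C.metric τ τ' (C.proj u))
          (diffField C.metric τ τ' (C.proj u))) • vecL m := by
  set L := diffField C.metric τ τ' (C.proj u) with hL
  have h1 : lor (vecL m) (C.Phi u L) = 0 := by rw [lor_vecL_left, Phi_iN]
  have h2 : lor (vecL m) (vecL m) = 0 := by rw [lor_vecL, vecL_iN]
  have h3 : lor (C.Phi u L) (C.eta τ' u) = 0 := by
    rw [C.lor_Phi_eta hτ', C.form_diffField hτ']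
  symm
  apply C.eq_eta hτ
  · simp only [lor_add_left, lor_sub_left, lor_smul_left, lor_add_right, lor_sub_right,
      lor_smul_right, lor_comm _ (vecL m), h1, h2, h3, lor_comm (C.eta τ' u) (C.Phi u L),
      C.eta_null, C.eta_pairing, metric_apply]
    ring
  · simp only [lor_add_right, lor_sub_right, lor_smul_right, h1, h2, C.eta_pairing]
    ring
  · intro w
    have h4 : lor (C.Phi u w) (vecL m) = 0 := by rw [lor_vecL, Phi_iN]
    rw [lor_sub_right, lor_add_right, lor_smul_right, C.lor_Phi_eta hτ', h4,
      lor_comm (C.Phi u w), ← metric_apply, C.metric_diffField hτ' hτ]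
    ring

variable [IsManifold (𝓡 (m + 1)) ∞ N]

/-- `Φ(L_{τ,τ'})` is the `τ'`-screen part of `η^τ`; in particular `L_{τ,τ'}` is smooth, although the
frame that defines it is chosen pointwise. -/
theorem scr_eta_eta (hτ : τ ∈ screenForms C.field) (hτ' : τ' ∈ screenForms C.field) (u : P) :
    scr (C.eta τ' u) (C.eta τ u) = C.PhiSec (diffField C.metric τ τ') u := by
  rw [C.eta_eq hτ.2 hτ'.2, scr_sub, scr_add, scr_smul, scr_vecL (C.eta_pairing τ' u),
    scr_self (C.eta_null τ' u) (C.eta_pairing τ' u), C.scr_eta_Phi hτ', C.form_diffField hτ'.2,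
    PhiSec]
  simp

theorem diffField_mem (hτ : τ ∈ screenForms C.field) (hτ' : τ' ∈ screenForms C.field) :
    diffField C.metric τ τ' ∈ screenSections τ' := by
  refine ⟨C.isSmoothField_of_PhiSec fun u => ?_, C.form_diffField hτ'.2⟩
  exact (contMDiffAt_scr ((C.isTractorSection_eta hτ').smooth u)
    ((C.isTractorSection_eta hτ).smooth u)).congr_of_eventuallyEq
      (Filter.Eventually.of_forall fun v => (C.scr_eta_eta hτ hτ' v).symm)

theorem conn_change (hτ : τ ∈ screenForms C.field) (hτ' : τ' ∈ screenForms C.field)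
    {X : VField (m + 1) N} (hX : X ∈ screenSections τ) (W : VField (m + 1) N) (x : N) :
    C.conn τ' (fun y => screenProj C.field τ' y (X y)) x (W x)
      = screenProj C.field τ' x (C.conn τ X x (W x) - τ' x (X x) • W x)
        - C.metric x (X x) (W x) • diffField C.metric τ τ' x := by
  obtain ⟨u, rfl⟩ := C.proj_surjective x
  have hΦ := (C.isTractorSection_PhiSec hX.1).smooth
  have hf := isSmoothFun_form hτ'.1 hX.1
  have hf' : IsSmoothFun (n := m + 1) (fun y => -τ' y (X y)) := ContMDiff.neg hf
  have hξ : ContMDiff (𝓡 d) 𝓘(ℝ, Vec m) ∞ (fun _ : P => vecL m) := contMDiff_const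
  have h1 : ContMDiff (𝓡 d) 𝓘(ℝ, Vec m) ∞
      (fun v : P => (-τ' (C.proj v) (X (C.proj v))) • vecL m) :=
    ContMDiff.smul (hf'.comp C.contMDiff_proj) hξ
  have e : C.PhiSec (fun y => screenProj C.field τ' y (X y))
      = fun v => C.PhiSec X v + (-τ' (C.proj v) (X (C.proj v))) • vecL m := by
    funext v
    rw [PhiSec, Phi_screenProj, neg_smul, ← sub_eq_add_neg]
    rfl
  have hS := C.isTractorSection_PhiSec_of_contMDiff
    (X := fun y => screenProj C.field τ' y (X y)) (by rw [e]; exact hΦ.add h1)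
  apply C.Phi_injective u
  have hW : C.tractorConn (fun _ => vecL m) u (W (C.proj u)) = C.Phi u (W (C.proj u)) := rfl
  rw [C.Phi_conn hτ' hS, e, C.tractorConn_add_left hΦ h1,
    C.tractorConn_smul_left (f := fun y => -τ' y (X y)) hf' hξ, hW,
    C.tractorConn_PhiSec hτ hX]
  simp only [scr_add, scr_sub, scr_smul, scr_vecL (C.eta_pairing τ' u), C.scr_eta_Phi hτ',
    C.scr_eta_eta hτ hτ', Phi_sub, Phi_smul, Phi_screenProj, map_sub, map_smul, PhiSec,
    smul_eq_mul]
  module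

theorem shape_change (hτ : τ ∈ screenForms C.field) (hτ' : τ' ∈ screenForms C.field)
    (W : VField (m + 1) N) (x : N) :
    C.shape τ' x (W x)
      = screenProj C.field τ' x
          (C.shape τ x (W x)
            + ((1 / 2 : ℝ) * C.metric x (diffField C.metric τ τ' x)
                (diffField C.metric τ τ' x)) • W x)
        - τ x (W x) • diffField C.metric τ τ' x
        - C.conn τ' (diffField C.metric τ τ') x (W x) := by
  obtain ⟨u, rfl⟩ := C.proj_surjective x
  have hL := C.diffField_mem hτ hτ'
  have hΦs := C.isTractorSection_PhiSec hL.1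
  have hΦ := hΦs.smooth
  have hη' := (C.isTractorSection_eta hτ').smooth
  set f : N → ℝ := fun y => (1 / 2 : ℝ) *
    C.metric y (diffField C.metric τ τ' y) (diffField C.metric τ τ' y) with hfdef
  have hf : IsSmoothFun (n := m + 1) (fun y => -f y) :=
    (ContMDiff.mul contMDiff_const (C.isSmoothFun_metric hL.1 hL.1)).neg
  have hξ : ContMDiff (𝓡 d) 𝓘(ℝ, Vec m) ∞ (fun _ : P => vecL m) := contMDiff_const
  have hfξ : ContMDiff (𝓡 d) 𝓘(ℝ, Vec m) ∞ (fun v : P => (-f (C.proj v)) • vecL m) :=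
    ContMDiff.smul (hf.comp C.contMDiff_proj) hξ
  have e : C.eta τ = fun v => C.eta τ' v + C.PhiSec (diffField C.metric τ τ') v
      + (-f (C.proj v)) • vecL m := by
    funext v
    rw [C.eta_eq hτ.2 hτ'.2, neg_smul, ← sub_eq_add_neg]
    rfl
  have hW : C.tractorConn (fun _ => vecL m) u (W (C.proj u)) = C.Phi u (W (C.proj u)) := rfl
  have h2 := congrArg (fun T => scr (C.eta τ' u) (C.tractorConn T u (W (C.proj u)))) e
  rw [C.tractorConn_eta hτ,
    C.tractorConn_add_left (S := fun v => C.eta τ' v + C.PhiSec (diffField C.metric τ τ') v)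
      (hη'.add hΦ) hfξ,
    C.tractorConn_add_left hη' hΦ, C.tractorConn_smul_left (f := fun y => -f y) hf hξ, hW] at h2
  simp only [scr_add, scr_sub, scr_smul, scr_vecL (C.eta_pairing τ' u), C.scr_eta_Phi hτ',
    C.scr_eta_eta hτ hτ', ← C.Phi_shape hτ', ← C.Phi_conn hτ' hΦs, PhiSec] at h2
  apply C.Phi_injective u
  simp only [Phi_add, Phi_sub, Phi_smul, Phi_screenProj, map_add, map_smul, smul_eq_mul]
  rw [← sub_eq_zero] at h2 ⊢
  rw [← neg_eq_zero, ← h2]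
  module

end LightlikeCartanGeometry

end LightlikeCartan

end
open LightlikeCartan in
theorem mainTheorem2 (m d : ℕ) (hm : 2 ≤ m)
    (N : Type*) [TopologicalSpace N] [ChartedSpace (EuclideanSpace ℝ (Fin (m + 1))) N]
    [IsManifold (𝓡 (m + 1)) ∞ N] [T2Space N] [SecondCountableTopology N] [ConnectedSpace N]
    (P : Type*) [TopologicalSpace P] [ChartedSpace (EuclideanSpace ℝ (Fin d)) P]
    [IsManifold (𝓡 d) ∞ P] [T2Space P] [SecondCountableTopology P]
    (C : LightlikeCartanGeometry m d N P) :
    ∃ (h : BilinField (m + 1) N) (Z : VField (m + 1) N),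
      (C.IsInducedMetric h ∧ C.IsInducedField Z) ∧
      (IsLightlikeMetric h ∧ SpansRadical h Z) ∧
      ∃ (conn : OneForm (m + 1) N → VField (m + 1) N → EndField (m + 1) N)
        (D : OneForm (m + 1) N → EndField (m + 1) N),
        (∀ τ ∈ screenForms Z, ∃ η : P → Vec m,
          C.IsTransverse τ η ∧ C.IsTractorForm h Z τ η (conn τ) (D τ)) ∧
        (∀ τ ∈ screenForms Z, IsMetricConnection h τ (conn τ)) ∧
        (∀ τ ∈ screenForms Z, IsScreenMorphism τ (D τ)) ∧
        (∀ τ ∈ screenForms Z, ∀ τ' ∈ screenForms Z, ∀ X ∈ screenSections τ,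
          ∀ W : VField (m + 1) N, IsSmoothField W → ∀ x : N,
            conn τ' (fun y => screenProj Z τ' y (X y)) x (W x)
              = screenProj Z τ' x (conn τ X x (W x) - τ' x (X x) • W x)
                - h x (X x) (W x) • diffField h τ τ' x) ∧
        (∀ τ ∈ screenForms Z, ∀ τ' ∈ screenForms Z,
          ∀ W : VField (m + 1) N, IsSmoothField W → ∀ x : N,
            D τ' x (W x)
              = screenProj Z τ' x
                  (D τ x (W x)
                    + ((1 / 2 : ℝ) * h x (diffField h τ τ' x) (diffField h τ τ' x)) • W x)
                - τ x (W x) • diffField h τ τ' x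
                - conn τ' (diffField h τ τ') x (W x)) := by
  exact ⟨C.metric, C.field, ⟨C.isInducedMetric_metric, C.isInducedField_field⟩,
    ⟨C.isLightlikeMetric_metric, C.spansRadical_field⟩, C.conn, C.shape,
    fun τ hτ => ⟨C.eta τ, C.isTransverse_eta hτ, C.isTractorForm hτ⟩,
    fun τ hτ => C.isMetricConnection_conn hτ,
    fun τ hτ => C.isScreenMorphism_shape hτ,
    fun τ hτ τ' hτ' X hX W _ x => C.conn_change hτ hτ' hX W x,
    fun τ hτ τ' hτ' W _ x => C.shape_change hτ hτ' W x⟩
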